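/- Let $q\ge 1$ and consider the recursion $$Y_t=\mathbf 1_{\{g(Y_{t-1},\ldots,Y_{t-q},\zeta_t)>0\}},\qquad t\in\mathbb Z,\tag{1}$$ where $(\zeta_t)_{t\in\mathbb Z}$ is a process with values in a measurable space $E'$ and $g:\{0,1\}^q\times E'\to\mathbb R$ is measurable. A solution is a $\{0,1\}$-valued process, defined on the same probability space, that satisfies (1) for all $t$ almost surely. 1. Assume that $(\zeta_t)_{t\in\mathbb Z}$ is stationary and ergodic and that $$\mathbb P\Big(\min_{y\in\{0,1\}^q,\,1\le t\le q} g(y,\zeta_t)>0\Big)+\mathbb P\Big(\max_{y\in\{0,1\}^q,\,1\le t\le q} g(y,\zeta_t)\le 0\Big)>0 .$$ Then there exists a stationary and ergodic solution $(Y_t)_{t\in\mathbb Z}$ of (1), and any stationary solution coincides with it almost surely. 2. Let $\xi_t=(\varepsilon_t,\eta_t)$, $t\in\mathbb Z$, be i.i.d. random variables with values in $\mathbb R\times G_1$, where $G_1$ is a measurable space. Let $Z_t=H'(\eta_t,\eta_{t-1},\ldots)$ almost surely for each $t$, with $H':G_1^{\mathbb N}\to\mathbb R^e$ measurable. Let $\mathcal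 F_t=\sigma(\xi_s:s\le t)$. Let $\xi_0'=(\varepsilon_0',\eta_0')$ be distributed as $\xi_0$ and independent of $(\xi_t)_{t\in\mathbb Z}$. Set $\overline\xi_0=\xi_0'$, $\overline\xi_t=\xi_t$ for $t\ne0$, and write $\overline\xi_t=(\overline\varepsilon_t,\overline\eta_t)$. Fix a norm $|\cdot|$ on $\mathbb R^e$ and $o\in(0,1]$. For $h\geq 0$ let $$\Theta_{1,h}(Z)=\sum_{t\ge h}\mathbb E\big|H'(\eta_t,\eta_{t-1},\ldots)-H'(\overline\eta_t,\overline\eta_{t-1},\ldots)\big|^o\in[0,\infty],$$ and, for a process $Y$ such that for each $t$ one has $Y_t=H(\xi_t,\xi_{t-1},\ldots)$ almost surely, with $H$ measurable and $\{0,1\}$-valued, let $$\Theta_{1,h}(Y)=\sum_{t\ge h}\mathbb E\big|H(\xi_t,\xi_{t-1},\ldots)-H(\overline\xi_t,\overline\xi_{t-1},\ldots)\big| .$$ Assume that $\zeta_t=(Z_{t-1},\varepsilon_t)$ and $g(y,\zeta_t)=\sum_{i=1}^q a_iy_i+\pi'Z_{t-1}+\varepsilon_t$ with $a_1,\ldots,a_q\in\mathbb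 R$ and $\pi\in\mathbb R^e$, and that the c.d.f. of $\varepsilon_t$ is Lipschitz and takes values in $(0,1)$. Put $\upsilon_t=\pi'Z_{t-1}+\varepsilon_t$, $\phi_+=\max_{y\in\{0,1\}^q}\sum_{i=1}^q a_iy_i$, $\phi_-=\min_{y\in\{0,1\}^q}\sum_{i=1}^q a_iy_i$, and assume that there exist $\delta>0$ and an integer $K\ge1$ such that $$\mathbb P\Big(\phi_-+\min_{1\le t\le q}\upsilon_t>0\,\Big|\,\mathcal F_{-K}\Big)+\mathbb P\Big(\phi_++\max_{1\le t\le q}\upsilon_t\le0\,\Big|\,\mathcal F_{-K}\Big)\ge\delta\quad\text{a.s.}$$ Then (1) has a stationary and ergodic solution $(Y_t)_{t\in\mathbb Z}$, any stationary solution coincides with it almost surely, it has a representation $Y_t=H(\xi_t,\xi_{t-1},\ldots)$ as above, and there exist $C>0$ and $\rho\in(0,1)$ such that, for every such representation and all $h\ge1$, $$\Theta_{1,h}(Y)\le C\Big[\rho^h+\sum_{i=1}^h\rho^i\,\Theta_{1,h-i}(Z)\Big].$$ -/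

import Mathlib

open MeasureTheory ProbabilityTheory
open scoped ENNReal

/-- The shift on two-sided sequences. -/
def seqShift {α : Type*} (x : ℤ → α) : ℤ → α := fun t => x (t + 1)

/-- The law of a process indexed by `ℤ`, as a measure on the product space `α ^ ℤ`. -/
noncomputable def processLaw {Ω α : Type*} [MeasurableSpace Ω] [MeasurableSpace α]
    (μ : Measure Ω) (X : ℤ → Ω → α) : Measure (ℤ → α) :=
  μ.map (fun ω t => X t ω)

/-- (Strict) stationarity: the law of the process is invariant under the shift. -/
def IsStationaryProcess {Ω α : Type*} [MeasurableSpace Ω] [MeasurableSpace α]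
    (μ : Measure Ω) (X : ℤ → Ω → α) : Prop :=
  MeasurePreserving seqShift (processLaw μ X) (processLaw μ X)

/-- Stationary and ergodic: the shift preserves the law of the process and is ergodic for it
(Mathlib's `Ergodic` contains `MeasurePreserving`). -/
def IsStationaryErgodicProcess {Ω α : Type*} [MeasurableSpace Ω] [MeasurableSpace α]
    (μ : Measure Ω) (X : ℤ → Ω → α) : Prop :=
  Ergodic seqShift (processLaw μ X)

/-- The process `Y`, with values in `{0, 1}`, satisfies almost surely, for all `t`,
`Y t = 1{g (Y (t-1), …, Y (t-q), ζ t) > 0}`. -/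
def IsBinaryChoiceSolution {Ω E : Type*} [MeasurableSpace Ω] (μ : Measure Ω) {q : ℕ}
    (g : (Fin q → Fin 2) → E → ℝ) (ζ : ℤ → Ω → E) (Y : ℤ → Ω → Fin 2) : Prop :=
  ∀ᵐ ω ∂μ, ∀ t : ℤ,
    Y t ω = if 0 < g (fun i : Fin q => Y (t - 1 - (i : ℤ)) ω) (ζ t ω) then 1 else 0

/-- `Y` is a stationary and ergodic solution, and it is, up to almost sure equality, the only
stationary solution. -/
def IsUniqueStationaryErgodicSolution {Ω E : Type*} [MeasurableSpace Ω] (μ : Measure Ω) {q : ℕ}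
    (g : (Fin q → Fin 2) → E → ℝ) (ζ : ℤ → Ω → E) (Y : ℤ → Ω → Fin 2) : Prop :=
  (∀ t, Measurable (Y t)) ∧ IsBinaryChoiceSolution μ g ζ Y ∧ IsStationaryErgodicProcess μ Y ∧
    ∀ Y' : ℤ → Ω → Fin 2, (∀ t, Measurable (Y' t)) → IsBinaryChoiceSolution μ g ζ Y' →
      IsStationaryProcess μ Y' → ∀ t, Y' t =ᵐ[μ] Y t

/-- The sequence `(ξ t, ξ (t-1), ξ (t-2), …)`. -/
def pastSeq {Ω G : Type*} (ξ : ℤ → Ω → G) (t : ℤ) (ω : Ω) : ℕ → G := fun j => ξ (t - (j : ℤ)) ω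

/-- The sigma-algebra generated by `ξ t, ξ (t-1), ξ (t-2), …`. -/
abbrev pastSigma {Ω G : Type*} [MeasurableSpace G] (ξ : ℤ → Ω → G) (t : ℤ) : MeasurableSpace Ω :=
  ⨆ j : ℕ, MeasurableSpace.comap (ξ (t - (j : ℤ))) inferInstance

/-- The sequence `ξ` with its term of index `0` replaced by `ξ₀'`. -/
def coupledSeq {Ω G : Type*} (ξ : ℤ → Ω → G) (ξ₀' : Ω → G) : ℤ → Ω → G :=
  Function.update ξ 0 ξ₀'

/-- The functional dependence coefficient `θ_{p,t}` of the Bernoulli shift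
`X t = H (ξ t, ξ (t-1), …)`: the `L^p` norm of the distance `d` between `X t` and its copy in which
`ξ 0` is replaced by `ξ₀'`. It takes values in `[0, ∞]`. -/
noncomputable def fdTheta {Ω G E : Type*} [MeasurableSpace Ω] (μ : Measure Ω)
    (ξ : ℤ → Ω → G) (ξ₀' : Ω → G) (d : E → E → ℝ) (H : (ℕ → G) → E) (p : ℝ≥0∞) (t : ℕ) : ℝ≥0∞ :=
  eLpNorm (fun ω => d (H (pastSeq ξ t ω)) (H (pastSeq (coupledSeq ξ ξ₀') t ω))) p μ

/-- The tail sum `Θ_{p,h} = ∑_{t ≥ h} θ_{p,t}`, with values in `[0, ∞]`. -/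
noncomputable def fdTail {Ω G E : Type*} [MeasurableSpace Ω] (μ : Measure Ω)
    (ξ : ℤ → Ω → G) (ξ₀' : Ω → G) (d : E → E → ℝ) (H : (ℕ → G) → E) (p : ℝ≥0∞) (h : ℕ) : ℝ≥0∞ :=
  ∑' k : ℕ, fdTheta μ ξ ξ₀' d H p (h + k)

/-- The usual distance on `{0, 1}`, seen as a subset of the real line. -/
noncomputable def binDist (y y' : Fin 2) : ℝ := |((y : ℕ) : ℝ) - ((y' : ℕ) : ℝ)|

/-- The linear form `a_1 y_1 + … + a_q y_q` on `{0, 1}^q`. -/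
noncomputable def lagSum {q : ℕ} (a : Fin q → ℝ) (y : Fin q → Fin 2) : ℝ :=
  ∑ i, a i * ((y i : ℕ) : ℝ)

/-- `φ₊`, the maximum of `a_1 y_1 + … + a_q y_q` over `{0, 1}^q`. -/
noncomputable def phiPlus {q : ℕ} (a : Fin q → ℝ) : ℝ := ⨆ y : Fin q → Fin 2, lagSum a y

/-- `φ₋`, the minimum of `a_1 y_1 + … + a_q y_q` over `{0, 1}^q`. -/
noncomputable def phiMinus {q : ℕ} (a : Fin q → ℝ) : ℝ := ⨅ y : Fin q → Fin 2, lagSum a y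

/-- The linear latent index `g (y, (z, u)) = a_1 y_1 + … + a_q y_q + π' z + u`. -/
noncomputable def linearIndex {q e : ℕ} (a : Fin q → ℝ) (b : Fin e → ℝ)
    (y : Fin q → Fin 2) (x : (Fin e → ℝ) × ℝ) : ℝ :=
  lagSum a y + b ⬝ᵥ x.1 + x.2

/-- `υ t = π' Z (t-1) + ε t`. -/
noncomputable def latentShock {Ω : Type*} {e : ℕ} (b : Fin e → ℝ) (Z : ℤ → Ω → (Fin e → ℝ))
    (ε : ℤ → Ω → ℝ) (t : ℤ) (ω : Ω) : ℝ :=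
  b ⬝ᵥ Z (t - 1) ω + ε t ω

/-! The key event is a reset: `q` consecutive times at which the index has one and the same sign
whatever the state. It forces the next `q` values, so two solutions driven by the same path coincide
afterwards (`eq_of_isReset`). If a reset has positive probability, ergodicity produces resets
arbitrarily far in the past (`ae_exists_lt_shiftBy_mem`). Runs of the recursion started in the
remote past therefore stabilise, and their eventual value `limitValue` is a function of the past of
the driving process. It solves the recursion, is ergodic as a factor of an ergodic process, and
agrees with every other solution from some reset on.

For the dependence bound, the solution is compared with its copy in which the term of index `0` of
`ξ` is replaced. Let `d m` be the probability that their last `q` values at time `m` differ, and let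
`B = K + q`. A difference at `m + B` requires one of two things. Either the states already differed
at `m` and there was no reset at `m + K`: this has probability at most `(1 - δ) * d m`, because a
difference at `m` depends only on the copy and on the past at `m`. Or, at some step of the block,
the original and the modified covariates give the index different signs: since the current shock is
independent of the past and has a Lipschitz c.d.f., this costs at most a constant times the
corresponding coefficient of `Z`. The resulting contraction over blocks (`measure_stateDiff_add_le`)
is summed in `exists_tail_bound`, with `ρ ^ B = 1 - δ`. -/

/-! ### Shifts of two-sided sequences and ergodicity of i.i.d. sequences. -/

theorem measurable_seqShift {α : Type*} [MeasurableSpace α] :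
    Measurable (seqShift : (ℤ → α) → ℤ → α) :=
  measurable_pi_lambda _ fun t => measurable_pi_apply (t + 1)

/-- The shift by `k` on two-sided sequences. -/
def shiftBy {α : Type*} (k : ℤ) (x : ℤ → α) : ℤ → α := fun t => x (t + k)

theorem measurable_shiftBy {α : Type*} [MeasurableSpace α] (k : ℤ) :
    Measurable (shiftBy k : (ℤ → α) → ℤ → α) :=
  measurable_pi_lambda _ fun t => measurable_pi_apply (t + k)

theorem shiftBy_shiftBy {α : Type*} (k l : ℤ) (x : ℤ → α) :
    shiftBy k (shiftBy l x) = shiftBy (k + l) x := by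
  funext t; simp [shiftBy, add_assoc]

theorem shiftBy_zero {α : Type*} (x : ℤ → α) : shiftBy 0 x = x := by
  funext t; simp [shiftBy]

/-- The shift is invertible with measurable inverse, so invariance extends to negative powers. These
are what moves an event into the past. -/
theorem measurePreserving_shiftBy {α : Type*} [MeasurableSpace α] {P : Measure (ℤ → α)}
    (hP : MeasurePreserving seqShift P P) (k : ℤ) : MeasurePreserving (shiftBy k) P P := by
  have h1 : MeasurePreserving (shiftBy 1) P P := hP
  have hm : MeasurePreserving (shiftBy (-1)) P P := by
    refine ⟨measurable_shiftBy _, ?_⟩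
    conv_lhs => rw [← h1.map_eq]
    rw [Measure.map_map (measurable_shiftBy _) (measurable_shiftBy _)]
    have : (shiftBy (-1) ∘ shiftBy 1 : (ℤ → α) → ℤ → α) = id := by
      funext x; simp [shiftBy_shiftBy, shiftBy_zero]
    rw [this, Measure.map_id]
  induction k with
  | zero =>
    have : (shiftBy 0 : (ℤ → α) → ℤ → α) = id := by funext x; simp [shiftBy_zero]
    rw [this]; exact MeasurePreserving.id P
  | succ n ih =>
    have : (shiftBy (n + 1) : (ℤ → α) → ℤ → α) = shiftBy n ∘ shiftBy 1 := by
      funext x; simp [shiftBy_shiftBy]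
    rw [this]; exact ih.comp h1
  | pred n ih =>
    have : (shiftBy (-n - 1) : (ℤ → α) → ℤ → α) = shiftBy (-n) ∘ shiftBy (-1) := by
      funext x; simp [shiftBy_shiftBy, sub_eq_add_neg]
    rw [this]; exact ih.comp hm

theorem measurePreserving_seqShift_infinitePi {α : Type*} [MeasurableSpace α] (ν : Measure α)
    [IsProbabilityMeasure ν] :
    MeasurePreserving seqShift (Measure.infinitePi fun _ : ℤ => ν)
      (Measure.infinitePi fun _ : ℤ => ν) :=
  ⟨measurable_seqShift, Measure.map_infinitePi_infinitePi_of_inj (P := fun _ : ℤ => ν)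
    (f := fun t : ℤ => t + 1) (add_left_injective 1)⟩

/-- Cylinder events that depend on far apart coordinates are independent. -/
theorem infinitePi_inter_shiftBy_preimage {α : Type*} [MeasurableSpace α] (ν : Measure α)
    [IsProbabilityMeasure ν] {C : Set (ℤ → α)} (hC : C ∈ measurableCylinders fun _ : ℤ => α) :
    ∃ n : ℤ, Measure.infinitePi (fun _ : ℤ => ν) (C ∩ shiftBy n ⁻¹' C) =
      Measure.infinitePi (fun _ : ℤ => ν) C * Measure.infinitePi (fun _ : ℤ => ν) C := by
  obtain ⟨I, S, hS, rfl⟩ := (mem_measurableCylinders _).1 hC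
  obtain ⟨M, hM⟩ : ∃ M : ℕ, ∀ i ∈ I, |i| ≤ M := by
    refine ⟨∑ i ∈ I, i.natAbs, fun i hi => ?_⟩
    have := Finset.single_le_sum (f := fun i : ℤ => i.natAbs) (fun _ _ => Nat.zero_le _) hi
    rw [Int.abs_eq_natAbs]; exact_mod_cast this
  -- The coordinates of `C` lie in `[-M, M]`, and a translation by `2 * M + 1` makes them disjoint
  -- from themselves.
  refine ⟨2 * M + 1, ?_⟩
  set n : ℤ := 2 * M + 1 with hn
  set P := Measure.infinitePi (fun _ : ℤ => ν)
  have hind : iIndepFun (fun (i : ℤ) (x : ℤ → α) => x i) P :=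
    iIndepFun_infinitePi (P := fun _ : ℤ => ν) (X := fun _ a => a) (fun _ => measurable_id)
  set J : Finset ℤ := I.image (· + n) with hJ
  have hdisj : Disjoint I J := by
    rw [Finset.disjoint_left]
    intro i hi hi'
    obtain ⟨j, hj, hji⟩ := Finset.mem_image.1 hi'
    have := abs_le.1 (hM i hi); have := abs_le.1 (hM j hj)
    omega
  have h2 := hind.indepFun_finset I J hdisj (fun i => measurable_pi_apply i)
  have hg : Measurable (fun (y : J → α) (i : I) => y ⟨i + n, Finset.mem_image_of_mem _ i.2⟩) :=
    measurable_pi_lambda _ fun i => measurable_pi_apply _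
  have h3 := h2.measure_inter_preimage_eq_mul S
    ((fun (y : J → α) (i : I) => y ⟨i + n, Finset.mem_image_of_mem _ i.2⟩) ⁻¹' S) hS (hg hS)
  have h4 : (fun (a : ℤ → α) (i : J) => a i) ⁻¹'
      ((fun (y : J → α) (i : I) => y ⟨i + n, Finset.mem_image_of_mem _ i.2⟩) ⁻¹' S) =
      shiftBy n ⁻¹' cylinder I S := rfl
  have h5 : (fun (a : ℤ → α) (i : I) => a i) ⁻¹' S = cylinder I S := rfl
  rw [h4, h5] at h3
  rw [h3, (measurePreserving_shiftBy (measurePreserving_seqShift_infinitePi ν) n).measure_preimage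
    (MeasurableSet.cylinder I hS).nullMeasurableSet]

/-- The shift is ergodic for the law of an i.i.d. sequence. -/
theorem ergodic_seqShift_infinitePi {α : Type*} [MeasurableSpace α] (ν : Measure α)
    [IsProbabilityMeasure ν] : Ergodic seqShift (Measure.infinitePi fun _ : ℤ => ν) := by
  set P := Measure.infinitePi (fun _ : ℤ => ν) with hP
  have hpres : MeasurePreserving seqShift P P := measurePreserving_seqShift_infinitePi ν
  refine { hpres with aeconst_set := fun s hs hinv => ?_ }
  have hk : ∀ k : ℤ, shiftBy k ⁻¹' s = s := by
    have h1 : ∀ x, shiftBy 1 x ∈ s ↔ x ∈ s := fun x => by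
      conv_rhs => rw [← hinv]
      rfl
    intro k
    ext x
    change shiftBy k x ∈ s ↔ x ∈ s
    induction k with
    | zero => rw [shiftBy_zero]
    | succ n ih => rw [← ih, ← h1 (shiftBy n x), shiftBy_shiftBy, add_comm]
    | pred n ih => rw [← ih, ← h1 (shiftBy (-n - 1) x), shiftBy_shiftBy]; ring_nf
  -- Mixing argument: if a cylinder `C` is `ε`-close to `s`, then by invariance so is each of its
  -- shifts, and `C ∩ shiftBy n ⁻¹' C` is `2ε`-close to `s` with measure `P(C)²`. Since `P(C)²` and
  -- `P(s)²` differ by at most `2ε`, the measure of `s` equals its square in the limit.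
  have hsq : ∀ ε : ℝ, 0 < ε → |P.real s - P.real s * P.real s| ≤ 4 * ε := by
    intro ε hε
    obtain ⟨C, hC, hCs⟩ := (Measure.MeasureDense.of_generateFrom_isSetAlgebra_finite P
      isSetAlgebra_measurableCylinders generateFrom_measurableCylinders.symm).approx s hs
      (measure_ne_top _ _) ε hε
    have hCm : MeasurableSet C := MeasurableSet.of_mem_measurableCylinders hC
    obtain ⟨n, hn⟩ := infinitePi_inter_shiftBy_preimage ν hC
    have hn' : P.real (C ∩ shiftBy n ⁻¹' C) = P.real C * P.real C := by
      simp only [measureReal_def, ← ENNReal.toReal_mul]; rw [hn]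
    have hd : P.real (symmDiff s C) ≤ ε :=
      ENNReal.toReal_le_of_le_ofReal hε.le hCs.le
    have hd' : P.real (symmDiff s (shiftBy n ⁻¹' C)) ≤ ε := by
      have : symmDiff s (shiftBy n ⁻¹' C) = shiftBy n ⁻¹' (symmDiff s C) := by
        rw [Set.preimage_symmDiff, hk]
      rw [this, measureReal_def, (measurePreserving_shiftBy hpres n).measure_preimage
        (hs.symmDiff hCm).nullMeasurableSet]
      exact hd
    have hd2 : P.real (symmDiff s (C ∩ shiftBy n ⁻¹' C)) ≤ 2 * ε := by
      calc _ ≤ P.real (symmDiff s C ∪ symmDiff s (shiftBy n ⁻¹' C)) := by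
            refine measureReal_mono ?_
            intro x hx
            simp only [Set.mem_symmDiff, Set.mem_union, Set.mem_inter_iff] at hx ⊢
            tauto
        _ ≤ _ := measureReal_union_le _ _
        _ ≤ 2 * ε := by linarith
    have e1 : |P.real s - P.real C * P.real C| ≤ 2 * ε := by
      rw [← hn']
      exact (abs_measureReal_sub_le_measureReal_symmDiff hs.nullMeasurableSet
        (hCm.inter (measurable_shiftBy n hCm)).nullMeasurableSet).trans hd2
    have e2 : |P.real s - P.real C| ≤ ε :=
      (abs_measureReal_sub_le_measureReal_symmDiff hs.nullMeasurableSet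
        hCm.nullMeasurableSet).trans hd
    have b1 : P.real s ≤ 1 := measureReal_le_one
    have b2 : P.real C ≤ 1 := measureReal_le_one
    have b3 : 0 ≤ P.real s := measureReal_nonneg
    have b4 : 0 ≤ P.real C := measureReal_nonneg
    rw [abs_le] at *
    constructor <;> nlinarith
  have h0 : P.real s - P.real s * P.real s = 0 := by
    by_contra hne
    have := hsq (|P.real s - P.real s * P.real s| / 8) (by positivity)
    have : 0 < |P.real s - P.real s * P.real s| := abs_pos.2 hne
    linarith
  rw [Filter.eventuallyConst_set']
  have : P.real s * (1 - P.real s) = 0 := by linarith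
  rcases mul_eq_zero.1 this with h | h
  · left
    rw [ae_eq_empty]
    exact (measureReal_eq_zero_iff).1 h
  · right
    rw [ae_eq_univ, ← measureReal_eq_zero_iff, probReal_compl_eq_one_sub hs, h]

/-- The past `(x t, x (t-1), x (t-2), …)` of a two-sided sequence. -/
def seqPast {α : Type*} (x : ℤ → α) (t : ℤ) : ℕ → α := fun j => x (t - (j : ℤ))

theorem measurable_seqPast {α : Type*} [MeasurableSpace α] (t : ℤ) :
    Measurable fun x : ℤ → α => seqPast x t :=
  measurable_pi_lambda _ fun j => measurable_pi_apply (t - (j : ℤ))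

theorem seqPast_shiftBy {α : Type*} (x : ℤ → α) (k t : ℤ) :
    seqPast (shiftBy k x) t = seqPast x (t + k) := by
  funext j; simp only [seqPast, shiftBy]; congr 1; ring

/-- A process whose values are, almost surely, a fixed measurable function of the past of a
stationary and ergodic process is stationary and ergodic. -/
theorem IsStationaryErgodicProcess.of_past {Ω α β : Type*} [MeasurableSpace Ω] [MeasurableSpace α]
    [MeasurableSpace β] {μ : Measure Ω} {X : ℤ → Ω → α} {Y : ℤ → Ω → β}
    (hX : ∀ t, Measurable (X t)) (h : IsStationaryErgodicProcess μ X) {F : (ℕ → α) → β}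
    (hF : Measurable F) (hY : ∀ t, Y t =ᵐ[μ] fun ω => F (pastSeq X t ω)) :
    IsStationaryErgodicProcess μ Y := by
  have hΦ : Measurable fun (x : ℤ → α) (t : ℤ) => F (seqPast x t) :=
    measurable_pi_lambda _ fun t => hF.comp (measurable_seqPast t)
  have hlaw : processLaw μ Y = (processLaw μ X).map fun (x : ℤ → α) t => F (seqPast x t) := by
    rw [processLaw, processLaw, Measure.map_map hΦ (measurable_pi_lambda _ hX)]
    refine Measure.map_congr ?_
    filter_upwards [ae_all_iff.2 hY] with ω hω
    funext t
    exact hω t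
  have hmp : MeasurePreserving (fun (x : ℤ → α) t => F (seqPast x t)) (processLaw μ X)
      (processLaw μ Y) := ⟨hΦ, hlaw.symm⟩
  -- The map from driving paths to solution paths commutes with the shift, and ergodicity passes to
  -- factors.
  refine hmp.ergodic_of_ergodic_semiconj h measurable_seqShift fun x => ?_
  funext t
  exact congrArg F (seqPast_shiftBy x 1 t)

/-! ### Pathwise study of the recursion: resets, runs from the remote past, recurrence of resets. -/

section Recursion

variable {E : Type*} {q : ℕ}

/-- `y` satisfies at time `t` the binary choice recursion driven by `x`. -/
def SatisfiesAt (g : (Fin q → Fin 2) → E → ℝ) (x : ℤ → E) (y : ℤ → Fin 2) (t : ℤ) : Prop :=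
  y t = if 0 < g (fun i : Fin q => y (t - 1 - (i : ℤ))) (x t) then 1 else 0

/-- At the `q` times following `s`, the recursion returns the same value from any state. -/
def IsReset (g : (Fin q → Fin 2) → E → ℝ) (x : ℤ → E) (s : ℤ) : Prop :=
  (∀ (r : Fin q) (y : Fin q → Fin 2), 0 < g y (x (s + ((r : ℤ) + 1)))) ∨
    ∀ (r : Fin q) (y : Fin q → Fin 2), g y (x (s + ((r : ℤ) + 1))) ≤ 0

/-- Solutions of the recursion on `(s, T]` that agree at the `q` times up to `s` agree up to
`T`. -/
theorem eq_of_satisfiesAt {g : (Fin q → Fin 2) → E → ℝ} {x : ℤ → E} {y y' : ℤ → Fin 2} {s T : ℤ}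
    (hy : ∀ t, s < t → t ≤ T → SatisfiesAt g x y t)
    (hy' : ∀ t, s < t → t ≤ T → SatisfiesAt g x y' t)
    (h : ∀ t, s - q < t → t ≤ s → y t = y' t) {t : ℤ} (hst : s - q < t) (htT : t ≤ T) :
    y t = y' t := by
  have key : ∀ (n : ℕ) (t : ℤ), s - q < t → t ≤ T → t ≤ s + n → y t = y' t := by
    intro n
    induction n with
    | zero => intro t h1 _ h2; exact h t h1 (by simpa using h2)
    | succ n ih =>
      intro t h1 hT h2
      by_cases h3 : t ≤ s + n
      · exact ih t h1 hT h3
      · push_cast at h2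
        rw [hy t (by omega) hT, hy' t (by omega) hT]
        have : (fun i : Fin q => y (t - 1 - (i : ℤ))) = fun i : Fin q => y' (t - 1 - (i : ℤ)) := by
          funext i
          have := i.2
          exact ih _ (by omega) (by omega) (by omega)
        rw [this]
  exact key (t - s).toNat t hst htT (by omega)

/-- Solutions of the recursion on `(s, T]` coincide after a reset at `s`. -/
theorem eq_of_isReset {g : (Fin q → Fin 2) → E → ℝ} {x : ℤ → E} {y y' : ℤ → Fin 2} {s T : ℤ}
    (hs : IsReset g x s) (hy : ∀ t, s < t → t ≤ T → SatisfiesAt g x y t)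
    (hy' : ∀ t, s < t → t ≤ T → SatisfiesAt g x y' t) {t : ℤ} (hst : s < t) (htT : t ≤ T) :
    y t = y' t := by
  -- In the `q` times after `s` the reset decides the value without looking at the state; once this
  -- window is filled, the recursion propagates the agreement.
  have hwin : ∀ t, s < t → t ≤ T → t ≤ s + q → y t = y' t := fun t h1 h2 h4 => by
    have h3 : x t = x (s + (((⟨(t - s - 1).toNat, by omega⟩ : Fin q) : ℤ) + 1)) := by
      congr 1; simp only; omega
    rw [hy t h1 h2, hy' t h1 h2, h3]
    rcases hs with hs | hs
    · rw [if_pos (hs _ _), if_pos (hs _ _)]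
    · rw [if_neg (hs _ _).not_gt, if_neg (hs _ _).not_gt]
  rcases le_or_gt t (s + q) with h | h
  · exact hwin t hst htT h
  · exact eq_of_satisfiesAt (s := s + q) (fun t h1 h2 => hy t (by omega) h2)
      (fun t h1 h2 => hy' t (by omega) h2) (fun t h1 h2 => hwin t (by omega) (by omega) h2)
      (by omega) htT

/-- The value at time `0` of the recursion started `n` steps earlier from the state `0`, as a
function of the past of the driving sequence. -/
noncomputable def forwardValue (g : (Fin q → Fin 2) → E → ℝ) : ℕ → (ℕ → E) → Fin 2
  | 0, _ => 0
  | n + 1, p =>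
    -- Truncated subtraction is intended: a lag reaching beyond the starting time gives index `0`,
    -- hence the initial state `0`.
    if 0 < g (fun i : Fin q => forwardValue g (n - i) fun j => p (j + (i + 1))) (p 0) then 1 else 0
  decreasing_by omega

theorem measurable_forwardValue [MeasurableSpace E] {g : (Fin q → Fin 2) → E → ℝ}
    (hg : Measurable (Function.uncurry g)) (n : ℕ) : Measurable (forwardValue g n) := by
  induction n using Nat.strong_induction_on with
  | _ n ih =>
    cases n with
    | zero =>
      have : forwardValue g 0 = fun _ => 0 := by funext p; rw [forwardValue]
      rw [this]; exact measurable_const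
    | succ n =>
      have : forwardValue g (n + 1) = fun p => if 0 < g (fun i : Fin q =>
          forwardValue g (n - i) fun j => p (j + (i + 1))) (p 0) then 1 else 0 := by
        funext p; rw [forwardValue]
      rw [this]
      refine Measurable.ite ?_ measurable_const measurable_const
      refine measurableSet_lt measurable_const (hg.comp (Measurable.prodMk ?_ ?_))
      · refine measurable_pi_lambda _ fun i => (ih (n - i) (by omega)).comp ?_
        exact measurable_pi_lambda _ fun j => measurable_pi_apply _
      · exact measurable_pi_apply 0

/-- Runs with a common starting time `s`, read along one path, form a single trajectory: it is `0`
up to `s`, where `toNat` vanishes, and obeys the recursion afterwards. -/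
theorem satisfiesAt_forwardValue (g : (Fin q → Fin 2) → E → ℝ) (x : ℤ → E) (s t : ℤ)
    (ht : s < t) :
    SatisfiesAt g x (fun t => forwardValue g (t - s).toNat (seqPast x t)) t := by
  obtain ⟨n, hn⟩ : ∃ n : ℕ, (t - s).toNat = n + 1 := ⟨(t - s).toNat - 1, by omega⟩
  simp only [SatisfiesAt]
  rw [hn, forwardValue]
  have h0 : seqPast x t 0 = x t := by simp [seqPast]
  have h1 : (fun i : Fin q => forwardValue g (n - i) fun j => seqPast x t (j + (i + 1))) =
      fun i : Fin q => forwardValue g (t - 1 - (i : ℤ) - s).toNat (seqPast x (t - 1 - i)) := by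
    funext i
    congr 1
    · omega
    · funext j; simp only [seqPast]; congr 1; push_cast; ring
  rw [h0, h1]

open Classical in
/-- The eventual value at time `0` of the recursion started in the remote past. -/
noncomputable def limitValue (g : (Fin q → Fin 2) → E → ℝ) (p : ℕ → E) : Fin 2 :=
  if ∃ m, ∀ n, m ≤ n → forwardValue g n p = 1 then 1 else 0

theorem measurable_limitValue [MeasurableSpace E] {g : (Fin q → Fin 2) → E → ℝ}
    (hg : Measurable (Function.uncurry g)) : Measurable (limitValue g) := by
  classical
  refine Measurable.ite ?_ measurable_const measurable_const
  have : {p : ℕ → E | ∃ m, ∀ n, m ≤ n → forwardValue g n p = 1} =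
      ⋃ m, ⋂ n, ⋂ _ : m ≤ n, forwardValue g n ⁻¹' {1} := by
    ext p; simp
  rw [this]
  exact MeasurableSet.iUnion fun m => MeasurableSet.iInter fun n => MeasurableSet.iInter fun _ =>
    measurable_forwardValue hg n (measurableSet_singleton _)

/-- Every run started at or before `s` passes through the reset, so `forwardValue g n` at time `t`
no longer depends on `n` once `n ≥ t - s`. -/
theorem limitValue_eq_forwardValue {g : (Fin q → Fin 2) → E → ℝ} {x : ℤ → E} {s t : ℤ}
    (hs : IsReset g x s) (ht : s < t) :
    limitValue g (seqPast x t) = forwardValue g (t - s).toNat (seqPast x t) := by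
  have hconst : ∀ n, (t - s).toNat ≤ n →
      forwardValue g n (seqPast x t) = forwardValue g (t - s).toNat (seqPast x t) := by
    intro n hn
    have h := eq_of_isReset hs (fun u hu _ => satisfiesAt_forwardValue g x (t - n) u (by omega))
      (fun u hu _ => satisfiesAt_forwardValue g x s u hu) ht le_rfl
    simpa using h
  by_cases h1 : forwardValue g (t - s).toNat (seqPast x t) = 1
  · rw [limitValue, if_pos ⟨_, fun n hn => (hconst n hn).trans h1⟩, h1]
  · rw [limitValue, if_neg]
    · generalize forwardValue g (t - s).toNat (seqPast x t) = v at h1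
      omega
    · rintro ⟨m, hm⟩
      exact h1 ((hconst _ (le_max_right m _)).symm.trans (hm _ (le_max_left _ _)))

theorem satisfiesAt_limitValue {g : (Fin q → Fin 2) → E → ℝ} {x : ℤ → E}
    (hx : ∀ t, ∃ s, s < t ∧ IsReset g x s) (t : ℤ) :
    SatisfiesAt g x (fun t => limitValue g (seqPast x t)) t := by
  -- A reset before `t - q` serves `t` and its `q` lags at once, so all these limit values come from
  -- one trajectory.
  obtain ⟨s, hst, hs⟩ := hx (t - q)
  have h := satisfiesAt_forwardValue g x s t (by omega)
  simp only [SatisfiesAt] at h ⊢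
  rw [limitValue_eq_forwardValue hs (by omega), h]
  have : (fun i : Fin q => limitValue g (seqPast x (t - 1 - (i : ℤ)))) = fun i : Fin q =>
      forwardValue g (t - 1 - (i : ℤ) - s).toNat (seqPast x (t - 1 - (i : ℤ))) := by
    funext i
    exact limitValue_eq_forwardValue hs (by omega)
  rw [this]

theorem measurableSet_isReset [MeasurableSpace E] {g : (Fin q → Fin 2) → E → ℝ}
    (hg : Measurable (Function.uncurry g)) (s : ℤ) :
    MeasurableSet {x : ℤ → E | IsReset g x s} := by
  have hm : ∀ (r : Fin q) (y : Fin q → Fin 2),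
      Measurable fun x : ℤ → E => g y (x (s + ((r : ℤ) + 1))) := fun r y =>
    hg.comp (measurable_const.prodMk (measurable_pi_apply _))
  have : {x : ℤ → E | IsReset g x s} =
      (⋂ (r : Fin q) (y : Fin q → Fin 2), {x | 0 < g y (x (s + ((r : ℤ) + 1)))}) ∪
      ⋂ (r : Fin q) (y : Fin q → Fin 2), {x | g y (x (s + ((r : ℤ) + 1))) ≤ 0} := by
    ext x; simp [IsReset]
  rw [this]
  exact (MeasurableSet.iInter fun r => MeasurableSet.iInter fun y =>
    measurableSet_lt measurable_const (hm r y)).union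
    (MeasurableSet.iInter fun r => MeasurableSet.iInter fun y =>
    measurableSet_le (hm r y) measurable_const)

theorem isReset_shiftBy {g : (Fin q → Fin 2) → E → ℝ} {x : ℤ → E} {s k : ℤ} :
    IsReset g (shiftBy k x) s ↔ IsReset g x (s + k) := by
  have : ∀ r : Fin q, shiftBy k x (s + ((r : ℤ) + 1)) = x (s + k + ((r : ℤ) + 1)) := fun r => by
    simp only [shiftBy]; congr 1; ring
  simp only [IsReset, this]

/-- An event of positive probability occurs infinitely often in the past of a stationary and
ergodic sequence. -/
theorem ae_exists_lt_shiftBy_mem [MeasurableSpace E] {P : Measure (ℤ → E)} [IsProbabilityMeasure P]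
    (hP : Ergodic seqShift P) {A : Set (ℤ → E)} (hA : MeasurableSet A) (hpos : 0 < P A) :
    ∀ᵐ x ∂P, ∀ t : ℤ, ∃ s, s < t ∧ shiftBy s x ∈ A := by
  set B : Set (ℤ → E) := {x | ∀ t : ℤ, ∃ s, s < t ∧ shiftBy s x ∈ A} with hB
  set U : ℕ → Set (ℤ → E) := fun n => ⋃ s : ℤ, ⋃ _ : s < -(n : ℤ), shiftBy s ⁻¹' A with hU
  have hUm : ∀ n, MeasurableSet (U n) := fun n =>
    MeasurableSet.iUnion fun s => MeasurableSet.iUnion fun _ => measurable_shiftBy s hA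
  have hBU : B = ⋂ n, U n := by
    ext x
    simp only [hB, hU, Set.mem_ofPred_eq, Set.mem_iInter, Set.mem_iUnion, Set.mem_preimage,
      exists_prop]
    refine ⟨fun h n => h _, fun h t => ?_⟩
    obtain ⟨s, hs, hs'⟩ := h (-t).toNat
    exact ⟨s, by omega, hs'⟩
  have hBm : MeasurableSet B := hBU ▸ MeasurableSet.iInter hUm
  have hanti : Antitone U := by
    intro m n hmn
    refine Set.iUnion_mono fun s => Set.iUnion_subset fun h => ?_
    exact Set.subset_iUnion_of_subset (by omega) subset_rfl
  -- `B` is the decreasing limit of the events `U n`, each of which contains a shifted copy of `A`.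
  -- So `B` has positive measure, and being invariant it has full measure.
  have hle : P A ≤ P B := by
    rw [hBU, hanti.measure_iInter (fun n => (hUm n).nullMeasurableSet) ⟨0, measure_ne_top _ _⟩]
    refine le_iInf fun n => ?_
    rw [← (measurePreserving_shiftBy hP.toMeasurePreserving (-(n : ℤ) - 1)).measure_preimage
      hA.nullMeasurableSet]
    refine measure_mono ?_
    exact Set.subset_iUnion_of_subset (-(n : ℤ) - 1)
      (Set.subset_iUnion_of_subset (by omega) subset_rfl)
  have hinv : seqShift ⁻¹' B = B := by
    ext x
    have h1 : ∀ s, shiftBy s (seqShift x) = shiftBy (s + 1) x := fun s => shiftBy_shiftBy s 1 x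
    simp only [hB, Set.mem_preimage, Set.mem_ofPred_eq, h1]
    constructor
    · intro h t
      obtain ⟨s, hs, hs'⟩ := h (t - 1)
      exact ⟨s + 1, by omega, hs'⟩
    · intro h t
      obtain ⟨s, hs, hs'⟩ := h (t + 1)
      exact ⟨s - 1, by omega, by simpa using hs'⟩
  rcases hP.toPreErgodic.measure_self_or_compl_eq_zero hBm hinv with h | h
  · exact absurd (hpos.trans_le hle) (by rw [h]; exact lt_irrefl _)
  · exact h

end Recursion

/-- If a reset has positive probability, the eventual value of the recursion is the only stationary
solution, and it is ergodic. -/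
theorem isUniqueStationaryErgodicSolution_limitValue {Ω E : Type*} [MeasurableSpace Ω]
    [MeasurableSpace E] {μ : Measure Ω} [IsProbabilityMeasure μ] {q : ℕ}
    {g : (Fin q → Fin 2) → E → ℝ} {ζ : ℤ → Ω → E} (hg : Measurable (Function.uncurry g))
    (hζ : ∀ t, Measurable (ζ t)) (herg : IsStationaryErgodicProcess μ ζ)
    (hpos : 0 < μ {ω | IsReset g (fun t => ζ t ω) 0}) :
    IsUniqueStationaryErgodicSolution μ g ζ fun t ω => limitValue g (pastSeq ζ t ω) := by
  have hζm : Measurable fun ω t => ζ t ω := measurable_pi_lambda _ hζ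
  have : IsProbabilityMeasure (processLaw μ ζ) := Measure.isProbabilityMeasure_map hζm.aemeasurable
  have hreset : ∀ᵐ ω ∂μ, ∀ t : ℤ, ∃ s, s < t ∧ IsReset g (fun t => ζ t ω) s := by
    have h := ae_exists_lt_shiftBy_mem herg (measurableSet_isReset hg 0)
      (by rwa [processLaw, Measure.map_apply hζm (measurableSet_isReset hg 0)])
    filter_upwards [ae_of_ae_map hζm.aemeasurable h] with ω hω t
    obtain ⟨s, hs, hs'⟩ := hω t
    refine ⟨s, hs, ?_⟩
    have := isReset_shiftBy.1 hs'
    rwa [zero_add] at this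
  refine ⟨fun t => (measurable_limitValue hg).comp (measurable_pi_lambda _ fun j => hζ _), ?_,
    herg.of_past hζ (measurable_limitValue hg) fun t => ae_eq_rfl, ?_⟩
  · filter_upwards [hreset] with ω hω t
    exact satisfiesAt_limitValue hω t
  · intro Y' _ hY' _ t
    filter_upwards [hreset, hY'] with ω hω hω'
    obtain ⟨s, hst, hs⟩ := hω t
    exact eq_of_isReset hs (y := fun t => Y' t ω) (fun u _ _ => hω' u)
      (fun u _ _ => satisfiesAt_limitValue hω u) hst le_rfl

/-! ### From a block contraction to bounds on tail sums. -/

theorem ENNReal.tsum_add_le_tsum (f : ℕ → ℝ≥0∞) (h j : ℕ) :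
    ∑' k, f (h + j + k) ≤ ∑' k, f (h + k) := by
  have := ENNReal.tsum_comp_le_tsum_of_injective (f := fun k : ℕ => j + k)
    (add_right_injective j) fun k => f (h + k)
  simpa [add_assoc] using this

/-- A contraction over blocks of length `B` passes to the sums of the tails. -/
theorem tsum_tail_add_le {d z : ℕ → ℝ≥0∞} {r c : ℝ≥0∞} {B : ℕ}
    (hrec : ∀ m, d (m + B) ≤ r * d m + c * ∑ j ∈ Finset.range B, z (m + j)) (h : ℕ) :
    ∑' k, d (h + B + k) ≤ r * ∑' k, d (h + k) + c * B * ∑' k, z (h + k) := by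
  calc ∑' k, d (h + B + k)
      ≤ ∑' k, (r * d (h + k) + c * ∑ j ∈ Finset.range B, z (h + k + j)) := by
        refine ENNReal.tsum_le_tsum fun k => ?_
        rw [add_right_comm]; exact hrec _
    _ = r * ∑' k, d (h + k) + c * ∑ j ∈ Finset.range B, ∑' k, z (h + j + k) := by
        rw [ENNReal.tsum_add, ENNReal.tsum_mul_left, ENNReal.tsum_mul_left,
          Summable.tsum_finsetSum fun _ _ => ENNReal.summable]
        simp only [add_right_comm]
    _ ≤ r * ∑' k, d (h + k) + c * ∑ _j ∈ Finset.range B, ∑' k, z (h + k) := by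
        gcongr _ + c * ?_
        exact Finset.sum_le_sum fun j _ => ENNReal.tsum_add_le_tsum z h j
    _ = _ := by rw [Finset.sum_const, Finset.card_range, nsmul_eq_mul, mul_assoc]

/-- The first `B` terms are at most `1` each, and the contraction bounds the others by `r` times the
sum itself. Working with partial sums, which are finite because `d ≤ 1`, allows that term to be
absorbed on the left. -/
theorem tsum_le_of_block_contraction {d z : ℕ → ℝ≥0∞} {r c : ℝ≥0∞} {B : ℕ} (hd : ∀ m, d m ≤ 1)
    (hr : r < 1)
    (hrec : ∀ m, d (m + B) ≤ r * d m + c * ∑ j ∈ Finset.range B, z (m + j)) :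
    ∑' k, d k ≤ (B + c * B * ∑' k, z k) / (1 - r) := by
  refine ENNReal.tsum_le_of_sum_range_le fun n => ?_
  set S := ∑ m ∈ Finset.range n, d m with hS
  have hfin : S ≠ ∞ := by
    refine (ENNReal.sum_lt_top.2 fun m _ => (hd m).trans_lt ENNReal.one_lt_top).ne
  have h1 : S ≤ B + (r * S + c * B * ∑' k, z k) := by
    calc S ≤ ∑ m ∈ Finset.range (B + n), d m :=
          Finset.sum_le_sum_of_subset (Finset.range_mono (by omega))
      _ = ∑ m ∈ Finset.range B, d m + ∑ m ∈ Finset.range n, d (B + m) :=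
          Finset.sum_range_add _ _ _
      _ ≤ ∑ m ∈ Finset.range B, 1 +
          ∑ m ∈ Finset.range n, (r * d m + c * ∑ j ∈ Finset.range B, z (m + j)) := by
          gcongr with m _ m _
          · exact hd m
          · rw [add_comm]; exact hrec m
      _ = B + (r * S + c * ∑ j ∈ Finset.range B, ∑ m ∈ Finset.range n, z (m + j)) := by
          rw [Finset.sum_add_distrib, ← Finset.mul_sum, ← Finset.mul_sum, Finset.sum_comm]
          simp [hS]
      _ ≤ B + (r * S + c * ∑ _j ∈ Finset.range B, ∑' k, z k) := by
          gcongr with j _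
          refine (ENNReal.sum_le_tsum (f := fun m => z (m + j)) _).trans ?_
          exact ENNReal.tsum_comp_le_tsum_of_injective (add_left_injective j) z
      _ = _ := by rw [Finset.sum_const, Finset.card_range, nsmul_eq_mul, mul_assoc]
  have h2 : (1 - r) * S ≤ B + c * B * ∑' k, z k := by
    rw [ENNReal.sub_mul fun _ _ => hfin, one_mul, tsub_le_iff_left]
    calc S ≤ _ := h1
      _ = _ := by ring
  rw [ENNReal.le_div_iff_mul_le (Or.inl (tsub_pos_of_lt hr).ne')
    (Or.inl (ENNReal.sub_ne_top ENNReal.one_ne_top)), mul_comm]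
  exact h2

/-- The tails of a sequence in `[0, 1]` that satisfies a contraction over blocks, with a
perturbation, are bounded by a convolution of the tails of the perturbation. -/
theorem exists_tail_bound {R c : ℝ≥0∞} {B : ℕ} (hB : 1 ≤ B) (hR0 : R ≠ 0) (hR1 : R < 1)
    (hc : c ≠ ∞) :
    ∃ C : ℝ, 0 < C ∧ ∀ d z : ℕ → ℝ≥0∞, (∀ m, d m ≤ 1) →
      (∀ m, d (m + B) ≤ R ^ B * d m + c * ∑ j ∈ Finset.range B, z (m + j)) →
      ∀ h, 1 ≤ h → ∑' k, d (h + k) ≤ ENNReal.ofReal C *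
        (R ^ h + ∑ i ∈ Finset.Icc 1 h, R ^ i * ∑' k, z (h - i + k)) := by
  have hRt : R ≠ ∞ := (hR1.trans ENNReal.one_lt_top).ne
  have hRB1 : R ^ B < 1 := pow_lt_one₀ zero_le hR1 (by omega)
  have hRB0 : R ^ B ≠ 0 := pow_ne_zero _ hR0
  have hRBt : R ^ B ≠ ∞ := ENNReal.pow_ne_top hRt
  set Q : ℝ≥0∞ := (B + c * B) / (1 - R ^ B) with hQ
  have hQt : Q ≠ ∞ := by
    refine ENNReal.div_ne_top ?_ (tsub_pos_of_lt hRB1).ne'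
    exact ENNReal.add_ne_top.2 ⟨ENNReal.natCast_ne_top _,
      ENNReal.mul_ne_top hc (ENNReal.natCast_ne_top _)⟩
  have hcBt : c * B ≠ ∞ := ENNReal.mul_ne_top hc (ENNReal.natCast_ne_top _)
  -- `K * R ^ B` must dominate both `Q`, for the base case `h ≤ B`, and `c * B`, for the induction
  -- step; the added `1` keeps `K` positive.
  set K : ℝ≥0∞ := (Q + c * B) / R ^ B + 1 with hK
  have hKt : K ≠ ∞ :=
    ENNReal.add_ne_top.2 ⟨ENNReal.div_ne_top (ENNReal.add_ne_top.2 ⟨hQt, hcBt⟩) hRB0,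
      ENNReal.one_ne_top⟩
  have hKR : Q + c * B ≤ K * R ^ B := by
    rw [← ENNReal.div_le_iff hRB0 hRBt]; exact le_self_add
  refine ⟨K.toReal, ENNReal.toReal_pos (by simp [hK]) hKt, fun d z hd hrec => ?_⟩
  rw [ENNReal.ofReal_toReal hKt]
  intro h
  induction h using Nat.strong_induction_on with
  | _ h ih =>
    intro h1
    rcases le_or_gt h B with hhB | hhB
    -- In the base case the single term `i = h` of the convolution already carries the full sum of
    -- `z`.
    · have hz : R ^ h * ∑' k, z k ≤ ∑ i ∈ Finset.Icc 1 h, R ^ i * ∑' k, z (h - i + k) := by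
        have := Finset.single_le_sum (f := fun i => R ^ i * ∑' k, z (h - i + k))
          (fun _ _ => zero_le) (Finset.mem_Icc.2 ⟨h1, le_rfl⟩)
        simpa using this
      calc ∑' k, d (h + k) ≤ ∑' k, d k := by simpa using ENNReal.tsum_add_le_tsum d 0 h
        _ ≤ (B + c * B * ∑' k, z k) / (1 - R ^ B) := tsum_le_of_block_contraction hd hRB1 hrec
        _ ≤ ((B + c * B) * (1 + ∑' k, z k)) / (1 - R ^ B) := by
            gcongr
            calc (B : ℝ≥0∞) + c * B * ∑' k, z k
                ≤ B + c * B * ∑' k, z k + (B * ∑' k, z k + c * B) := le_self_add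
              _ = _ := by ring
        _ = Q * (1 + ∑' k, z k) := by rw [hQ, ENNReal.mul_div_right_comm]
        _ ≤ K * R ^ B * (1 + ∑' k, z k) := by
            gcongr; exact le_self_add.trans hKR
        _ ≤ K * R ^ h * (1 + ∑' k, z k) := by
            gcongr K * ?_ * _
            exact pow_le_pow_right_of_le_one' hR1.le hhB
        _ = K * (R ^ h + R ^ h * ∑' k, z k) := by ring
        _ ≤ _ := by gcongr
    · obtain ⟨h', rfl⟩ : ∃ h', h = h' + B := ⟨h - B, by omega⟩
      -- One block shifts the convolution index from `i` to `i + B`. The index `B` is left free by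
      -- this and receives the new perturbation.
      have hsum : ∑ i ∈ Finset.Icc 1 h', R ^ (i + B) * ∑' k, z (h' - i + k) +
          R ^ B * ∑' k, z (h' + k) ≤
          ∑ i ∈ Finset.Icc 1 (h' + B), R ^ i * ∑' k, z (h' + B - i + k) := by
        set f : ℕ → ℝ≥0∞ := fun i => R ^ i * ∑' k, z (h' + B - i + k) with hf
        have e1 : ∑ i ∈ Finset.Icc 1 h', R ^ (i + B) * ∑' k, z (h' - i + k) =
            ∑ i ∈ (Finset.Icc 1 h').image (· + B), f i := by
          rw [Finset.sum_image fun _ _ _ _ h => add_left_injective B h]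
          refine Finset.sum_congr rfl fun i _ => ?_
          simp [hf, Nat.add_sub_add_right]
        have e2 : R ^ B * ∑' k, z (h' + k) = f B := by simp [hf]
        have hnot : B ∉ (Finset.Icc 1 h').image (· + B) := by
          simp
        rw [e1, e2, add_comm, ← Finset.sum_insert hnot]
        refine Finset.sum_le_sum_of_subset fun i hi => ?_
        rw [Finset.mem_insert, Finset.mem_image] at hi
        rw [Finset.mem_Icc]
        rcases hi with rfl | ⟨j, hj, rfl⟩
        · omega
        · have := Finset.mem_Icc.1 hj; omega
      calc ∑' k, d (h' + B + k) ≤ R ^ B * ∑' k, d (h' + k) + c * B * ∑' k, z (h' + k) :=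
            tsum_tail_add_le hrec h'
        _ ≤ R ^ B * (K * (R ^ h' + ∑ i ∈ Finset.Icc 1 h', R ^ i * ∑' k, z (h' - i + k))) +
            K * R ^ B * ∑' k, z (h' + k) := by
            refine add_le_add ?_ (mul_le_mul_left (le_add_self.trans hKR) _)
            exact mul_le_mul_right (ih h' (by omega) (by omega)) _
        _ = K * (R ^ (h' + B) + (∑ i ∈ Finset.Icc 1 h', R ^ (i + B) * ∑' k, z (h' - i + k) +
            R ^ B * ∑' k, z (h' + k))) := by
            have : ∑ i ∈ Finset.Icc 1 h', R ^ (i + B) * ∑' k, z (h' - i + k) =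
                R ^ B * ∑ i ∈ Finset.Icc 1 h', R ^ i * ∑' k, z (h' - i + k) := by
              rw [Finset.mul_sum]
              exact Finset.sum_congr rfl fun i _ => by ring
            rw [this]; ring
        _ ≤ _ := by gcongr

/-! ### Norm comparison and the effect of a Lipschitz c.d.f. -/

theorem Seminorm.continuous_of_pi {e : ℕ} (N : Seminorm ℝ (Fin e → ℝ)) : Continuous N :=
  (ConvexOn.locallyLipschitz N.convexOn).continuous

/-- A linear form is bounded by a multiple of any norm. -/
theorem Seminorm.exists_abs_dotProduct_le {e : ℕ} (N : Seminorm ℝ (Fin e → ℝ))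
    (hN : ∀ z, N z = 0 → z = 0) (b : Fin e → ℝ) : ∃ M : ℝ, 0 ≤ M ∧ ∀ z, |b ⬝ᵥ z| ≤ M * N z := by
  have hb : Continuous fun z : Fin e → ℝ => b ⬝ᵥ z := by
    simp only [dotProduct]; fun_prop
  -- The ratio is invariant under positive scaling, so its bound on the compact unit sphere holds at
  -- every nonzero `z`.
  have hcont : ContinuousOn (fun z : Fin e → ℝ => b ⬝ᵥ z / N z) (Metric.sphere 0 1) := by
    refine hb.continuousOn.div N.continuous_of_pi.continuousOn fun z hz h => ?_
    rw [hN z h] at hz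
    simp at hz
  obtain ⟨M, hM⟩ := (isCompact_sphere (0 : Fin e → ℝ) 1).exists_bound_of_continuousOn hcont
  refine ⟨max M 0, le_max_right _ _, fun z => ?_⟩
  rcases eq_or_ne z 0 with rfl | hz
  · simp
  have hz' : 0 < ‖z‖ := norm_pos_iff.2 hz
  have hmem : ‖z‖⁻¹ • z ∈ Metric.sphere (0 : Fin e → ℝ) 1 := by
    simp [norm_smul, hz'.ne']
  have h1 := hM _ hmem
  have hNz : 0 < N z := lt_of_le_of_ne (apply_nonneg N z) fun h => hz (hN z h.symm)
  rw [dotProduct_smul, map_smul_eq_mul, smul_eq_mul, norm_inv, norm_norm,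
    mul_div_mul_left _ _ (inv_ne_zero hz'.ne'), Real.norm_eq_abs, abs_div, abs_of_pos hNz,
    div_le_iff₀ hNz] at h1
  exact h1.trans (mul_le_mul_of_nonneg_right (le_max_left _ _) hNz.le)

/-- A probability is bounded both by `1` and linearly in the distance. For `o ≤ 1` the power `N z ^
o` controls both regimes: it is at least `1` if `N z ≥ 1`, and at least `N z` otherwise. -/
theorem Seminorm.exists_min_one_le {e : ℕ} (N : Seminorm ℝ (Fin e → ℝ))
    (hN : ∀ z, N z = 0 → z = 0) (b : Fin e → ℝ) (L : ℝ) (hL : 0 ≤ L) {o : ℝ} (ho : 0 < o)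
    (ho1 : o ≤ 1) :
    ∃ c : ℝ≥0∞, c ≠ ∞ ∧ ∀ z, min 1 (ENNReal.ofReal (L * |b ⬝ᵥ z|)) ≤ c * ‖N z ^ o‖ₑ := by
  obtain ⟨M, hM, hMz⟩ := N.exists_abs_dotProduct_le hN b
  refine ⟨ENNReal.ofReal (max 1 (L * M)), ENNReal.ofReal_ne_top, fun z => ?_⟩
  have hNz : 0 ≤ N z := apply_nonneg N z
  have hNo : 0 ≤ N z ^ o := Real.rpow_nonneg hNz o
  rw [Real.enorm_of_nonneg hNo, ← ENNReal.ofReal_mul (by positivity), ← ENNReal.ofReal_one,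
    ← ENNReal.ofReal_min]
  refine ENNReal.ofReal_le_ofReal ?_
  rcases le_or_gt 1 (N z) with h | h
  · refine (min_le_left _ _).trans ?_
    have := Real.one_le_rpow h ho.le
    nlinarith [le_max_left 1 (L * M)]
  · refine (min_le_right _ _).trans ?_
    have h1 : N z ≤ N z ^ o := by
      rcases hNz.eq_or_lt with h0 | h0
      · rw [← h0, Real.zero_rpow ho.ne']
      · exact Real.self_le_rpow_of_le_one hNz h.le ho1
    calc L * |b ⬝ᵥ z| ≤ L * (M * N z) := by gcongr; exact hMz z
      _ = L * M * N z := by ring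
      _ ≤ max 1 (L * M) * N z ^ o := by
        gcongr
        exact le_max_right _ _

/-- A law with a Lipschitz distribution function charges the interval between two thresholds at
most proportionally to its length. -/
theorem measure_threshold_le {lam : Measure ℝ} [IsProbabilityMeasure lam] {L : NNReal}
    (hL : LipschitzWith L (cdf lam)) (a b : ℝ) :
    lam {u | ¬(0 < a + u ↔ 0 < b + u)} ≤ min 1 (ENNReal.ofReal (L * |a - b|)) := by
  refine le_min prob_le_one ?_
  have key : ∀ a b : ℝ, lam (Set.Ioc a b) ≤ ENNReal.ofReal (L * |a - b|) := fun a b => by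
    rw [← measure_cdf lam, StieltjesFunction.measure_Ioc]
    refine ENNReal.ofReal_le_ofReal ?_
    have h := hL.dist_le_mul b a
    rw [Real.dist_eq, Real.dist_eq, abs_sub_comm b a] at h
    exact (le_abs_self _).trans h
  rcases le_total a b with hab | hab
  -- The strict inequality `0 <` makes the separating set half-open on the left, so its mass is
  -- exactly an increment of the c.d.f.
  · refine (measure_mono (t := Set.Ioc (-b) (-a)) fun u hu => ?_).trans ((key _ _).trans ?_)
    · simp only [Set.mem_ofPred_eq, not_iff, not_lt] at hu
      rw [Set.mem_Ioc]
      by_cases h : 0 < b + u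
      · have := hu.2 h; constructor <;> linarith
      · exact absurd (hu.1 (by linarith)) h
    · rw [show -b - -a = a - b by ring]
  · refine (measure_mono (t := Set.Ioc (-a) (-b)) fun u hu => ?_).trans ((key _ _).trans ?_)
    · simp only [Set.mem_ofPred_eq, not_iff, not_lt] at hu
      rw [Set.mem_Ioc]
      by_cases h : 0 < b + u
      · have := hu.2 h; linarith
      · by_cases h' : a + u ≤ 0
        · exact absurd (hu.1 h') h
        · constructor <;> linarith
    · rw [show -a - -b = -(a - b) by ring, abs_neg]

/-! ### The canonical space: an i.i.d. sequence together with an independent copy of one term. -/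

section Product

variable {G : Type*} [MeasurableSpace G] (ν : Measure G) [IsProbabilityMeasure ν]

theorem measurable_update_zero :
    Measurable fun p : G × (ℤ → G) => Function.update p.2 0 p.1 := by
  refine measurable_pi_lambda _ fun t => ?_
  by_cases ht : t = 0
  · subst ht; simpa using measurable_fst
  · simp only [Function.update_of_ne ht]
    exact (measurable_pi_apply t).comp measurable_snd

/-- Replacing one term of an i.i.d. sequence by an independent copy does not change its law. -/
theorem map_update_prod_infinitePi :
    (ν.prod (Measure.infinitePi fun _ : ℤ => ν)).map
      (fun p : G × (ℤ → G) => Function.update p.2 0 p.1) = Measure.infinitePi fun _ : ℤ => ν := by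
  refine Measure.eq_infinitePi _ fun s t ht => ?_
  rw [Measure.map_apply measurable_update_zero
    (MeasurableSet.pi s.countable_toSet fun i _ => ht i)]
  by_cases h0 : (0 : ℤ) ∈ s
  -- The constraint at index `0` moves to the fresh coordinate, and the original term of index `0`
  -- becomes free.
  · have : (fun p : G × (ℤ → G) => Function.update p.2 0 p.1) ⁻¹' (Set.pi s t) =
        t 0 ×ˢ Set.pi (s.erase 0 : Finset ℤ) t := by
      ext p
      simp only [Set.mem_preimage, Set.mem_pi, Finset.mem_coe, Set.mem_prod, Finset.mem_erase]
      constructor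
      · intro h
        refine ⟨by simpa using h 0 h0, fun i hi => ?_⟩
        simpa [Function.update_of_ne hi.1] using h i hi.2
      · intro h i hi
        by_cases hi0 : i = 0
        · subst hi0; simpa using h.1
        · simpa [Function.update_of_ne hi0] using h.2 i ⟨hi0, hi⟩
    rw [this, Measure.prod_prod, Measure.infinitePi_pi _ fun i _ => ht i,
      Finset.mul_prod_erase s (fun i => ν (t i)) h0]
  · have : (fun p : G × (ℤ → G) => Function.update p.2 0 p.1) ⁻¹' (Set.pi s t) =
        Set.univ ×ˢ Set.pi (s : Set ℤ) t := by
      ext p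
      simp only [Set.mem_preimage, Set.mem_pi, Finset.mem_coe, Set.mem_prod, Set.mem_univ,
        true_and]
      refine forall₂_congr fun i hi => ?_
      rw [Function.update_of_ne (ne_of_mem_of_not_mem hi h0)]
    rw [this, Measure.prod_prod, Measure.infinitePi_pi _ fun i _ => ht i, measure_univ, one_mul]

/-- In an i.i.d. sequence, the term of index `u` is independent of the strict past. -/
theorem map_seqPast_prod_eval (u : ℤ) :
    (Measure.infinitePi fun _ : ℤ => ν).map (fun x => (seqPast x (u - 1), x u)) =
      ((Measure.infinitePi fun _ : ℤ => ν).map fun x => seqPast x (u - 1)).prod ν := by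
  set P := Measure.infinitePi fun _ : ℤ => ν
  have hind : iIndepFun (fun (i : ℤ) (x : ℤ → G) => x i) P :=
    iIndepFun_infinitePi (P := fun _ : ℤ => ν) (X := fun _ a => a) (fun _ => measurable_id)
  have h1 := indep_iSup_of_disjoint (fun i => (measurable_pi_apply i).comap_le) hind.iIndep
    (S := Set.Iio u) (T := {u}) (by simp)
  have h2 : IndepFun (fun x : ℤ → G => seqPast x (u - 1)) (fun x => x u) P := by
    rw [IndepFun_iff_Indep]
    refine indep_of_indep_of_le_left (indep_of_indep_of_le_right h1 ?_) ?_
    · exact le_iSup₂_of_le u rfl le_rfl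
    · rw [MeasurableSpace.pi, MeasurableSpace.comap_iSup]
      refine iSup_le fun j => ?_
      rw [MeasurableSpace.comap_comp]
      refine le_iSup₂_of_le (u - 1 - (j : ℤ)) ?_ le_rfl
      simp only [Set.mem_Iio]; omega
  rw [h2.map_prod_eq_prod_map_map (measurable_seqPast _).aemeasurable
    (measurable_pi_apply u).aemeasurable, Measure.infinitePi_map_eval]

end Product

theorem measurableSet_threshold {T : Type*} [MeasurableSpace T] {A B : T → ℝ} (hA : Measurable A)
    (hB : Measurable B) : MeasurableSet {x | ¬(0 < A x ↔ 0 < B x)} := by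
  have h1 : MeasurableSet {x | 0 < A x} := measurableSet_lt measurable_const hA
  have h2 : MeasurableSet {x | 0 < B x} := measurableSet_lt measurable_const hB
  have : {x | ¬(0 < A x ↔ 0 < B x)} = symmDiff {x | 0 < A x} {x | 0 < B x} := by
    ext x; simp only [Set.mem_ofPred_eq, Set.mem_symmDiff]; tauto
  rw [this]
  exact h1.symmDiff h2

section Thresholds

variable {G₁ : Type*} [MeasurableSpace G₁] {ν : Measure (ℝ × G₁)} [IsProbabilityMeasure ν]

/-- Two thresholds that depend on the strict past separate the current shock with a probability
bounded by their mean distance. -/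
theorem infinitePi_threshold_le {L : NNReal} (hL : LipschitzWith L (cdf (ν.map Prod.fst))) (u : ℤ)
    {A B : (ℕ → ℝ × G₁) → ℝ} (hA : Measurable A) (hB : Measurable B) :
    (Measure.infinitePi fun _ : ℤ => ν) {x | ¬(0 < A (seqPast x (u - 1)) + (x u).1 ↔
        0 < B (seqPast x (u - 1)) + (x u).1)} ≤
      ∫⁻ x, min 1 (ENNReal.ofReal (L * |A (seqPast x (u - 1)) - B (seqPast x (u - 1))|))
        ∂Measure.infinitePi fun _ : ℤ => ν := by
  set P := Measure.infinitePi fun _ : ℤ => ν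
  have : IsProbabilityMeasure (ν.map Prod.fst) :=
    Measure.isProbabilityMeasure_map measurable_fst.aemeasurable
  set S : Set ((ℕ → ℝ × G₁) × (ℝ × G₁)) :=
    {y | ¬(0 < A y.1 + y.2.1 ↔ 0 < B y.1 + y.2.1)} with hS
  have hSm : MeasurableSet S := measurableSet_threshold
    ((hA.comp measurable_fst).add (measurable_fst.comp measurable_snd))
    ((hB.comp measurable_fst).add (measurable_fst.comp measurable_snd))
  have hpair : Measurable fun x : ℤ → ℝ × G₁ => (seqPast x (u - 1), x u) :=
    (measurable_seqPast _).prodMk (measurable_pi_apply u)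
  have h1 : P {x | ¬(0 < A (seqPast x (u - 1)) + (x u).1 ↔ 0 < B (seqPast x (u - 1)) + (x u).1)} =
      (P.map fun x => (seqPast x (u - 1), x u)) S := by
    rw [Measure.map_apply hpair hSm]; rfl
  rw [h1, map_seqPast_prod_eval, Measure.prod_apply hSm,
    lintegral_map (measurable_measure_prodMk_left hSm) (measurable_seqPast _)]
  refine lintegral_mono fun x => ?_
  refine le_trans (le_of_eq ?_) (measure_threshold_le hL _ _)
  have hm : MeasurableSet {v : ℝ | ¬(0 < A (seqPast x (u - 1)) + v ↔
      0 < B (seqPast x (u - 1)) + v)} :=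
    measurableSet_threshold (measurable_const.add measurable_id)
      (measurable_const.add measurable_id)
  rw [Measure.map_apply measurable_fst hm]
  rfl

/-- The copy is only a parameter: with it fixed, the estimate for one sequence applies, and Fubini
integrates it out. The thresholds may thus depend on the copy as well as on the strict past. -/
theorem prod_infinitePi_threshold_le {L : NNReal} (hL : LipschitzWith L (cdf (ν.map Prod.fst)))
    (u : ℤ) {A B : (ℝ × G₁) × (ℕ → ℝ × G₁) → ℝ} (hA : Measurable A) (hB : Measurable B) :
    (ν.prod (Measure.infinitePi fun _ : ℤ => ν))
      {p | ¬(0 < A (p.1, seqPast p.2 (u - 1)) + (p.2 u).1 ↔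
        0 < B (p.1, seqPast p.2 (u - 1)) + (p.2 u).1)} ≤
      ∫⁻ p, min 1 (ENNReal.ofReal
        (L * |A (p.1, seqPast p.2 (u - 1)) - B (p.1, seqPast p.2 (u - 1))|))
        ∂(ν.prod (Measure.infinitePi fun _ : ℤ => ν)) := by
  have hpast : Measurable fun p : (ℝ × G₁) × (ℤ → ℝ × G₁) => (p.1, seqPast p.2 (u - 1)) :=
    measurable_fst.prodMk ((measurable_seqPast _).comp measurable_snd)
  have hcur : Measurable fun p : (ℝ × G₁) × (ℤ → ℝ × G₁) => (p.2 u).1 :=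
    measurable_fst.comp ((measurable_pi_apply u).comp measurable_snd)
  have hm : MeasurableSet {p : (ℝ × G₁) × (ℤ → ℝ × G₁) |
      ¬(0 < A (p.1, seqPast p.2 (u - 1)) + (p.2 u).1 ↔
        0 < B (p.1, seqPast p.2 (u - 1)) + (p.2 u).1)} :=
    measurableSet_threshold ((hA.comp hpast).add hcur) ((hB.comp hpast).add hcur)
  rw [Measure.prod_apply hm, lintegral_prod]
  · refine lintegral_mono fun x' => ?_
    exact infinitePi_threshold_le hL u (A := fun p => A (x', p)) (B := fun p => B (x', p))
      (hA.comp measurable_prodMk_left) (hB.comp measurable_prodMk_left)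
  · refine Measurable.aemeasurable (measurable_const.min ?_)
    refine ENNReal.measurable_ofReal.comp (measurable_const.mul ?_)
    have := (hA.comp hpast).sub (hB.comp hpast)
    exact this.abs

end Thresholds

theorem measurable_lagSum {q : ℕ} (a : Fin q → ℝ) : Measurable (lagSum a) :=
  Measurable.of_discrete

theorem measurable_linearIndex {q e : ℕ} (a : Fin q → ℝ) (b : Fin e → ℝ) :
    Measurable (Function.uncurry (linearIndex a b)) := by
  have hb : Measurable fun z : Fin e → ℝ => b ⬝ᵥ z := by
    simp only [dotProduct]; fun_prop
  exact (((measurable_lagSum a).comp measurable_fst).add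
    (hb.comp (measurable_fst.comp measurable_snd))).add (measurable_snd.comp measurable_snd)

/-! ### Coupling of the solution with its modified copy. -/

section Driving

variable {G₁ : Type*} {e : ℕ}

/-- The sequence `(Z (t-1), ε t)` as a function of the sequence `ξ`. -/
def drivingSeq (Z : (ℕ → ℝ × G₁) → Fin e → ℝ) (x : ℤ → ℝ × G₁) (t : ℤ) : (Fin e → ℝ) × ℝ :=
  (Z (seqPast x (t - 1)), (x t).1)

theorem drivingSeq_shiftBy (Z : (ℕ → ℝ × G₁) → Fin e → ℝ) (x : ℤ → ℝ × G₁) (k : ℤ) :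
    drivingSeq Z (shiftBy k x) = shiftBy k (drivingSeq Z x) := by
  funext t
  simp only [drivingSeq, seqPast_shiftBy, shiftBy]
  rw [show t - 1 + k = t + k - 1 by ring]

theorem measurable_drivingSeq [MeasurableSpace G₁] {Z : (ℕ → ℝ × G₁) → Fin e → ℝ}
    (hZ : Measurable Z) : Measurable (drivingSeq Z) :=
  measurable_pi_lambda _ fun t => (hZ.comp (measurable_seqPast _)).prodMk
    (measurable_fst.comp (measurable_pi_apply t))

/-- The past at time `k` after replacement of the term of index `0` of the sequence. -/
def pastUpdate {G : Type*} (k : ℤ) (y : G × (ℕ → G)) : ℕ → G :=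
  fun j => if k - (j : ℤ) = 0 then y.1 else y.2 j

theorem seqPast_update {G : Type*} (k : ℤ) (x : ℤ → G) (x' : G) :
    seqPast (Function.update x 0 x') k = pastUpdate k (x', seqPast x k) := by
  funext j
  simp only [seqPast, pastUpdate, Function.update_apply]

theorem measurable_pastUpdate {G : Type*} [MeasurableSpace G] (k : ℤ) :
    Measurable (pastUpdate k : G × (ℕ → G) → ℕ → G) := by
  refine measurable_pi_lambda _ fun j => ?_
  by_cases h : k - (j : ℤ) = 0
  · simp only [pastUpdate, h, if_true]; exact measurable_fst
  · simp only [pastUpdate, h, if_false]; exact (measurable_pi_apply j).comp measurable_snd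

/-- The sequence obtained by deleting the first `i` terms. -/
def dropSeq {G : Type*} (i : ℕ) (p : ℕ → G) : ℕ → G := fun j => p (i + j)

theorem measurable_dropSeq {G : Type*} [MeasurableSpace G] (i : ℕ) :
    Measurable (dropSeq i : (ℕ → G) → ℕ → G) :=
  measurable_pi_lambda _ fun j => measurable_pi_apply (i + j)

theorem seqPast_sub {G : Type*} (x : ℤ → G) (k : ℤ) (i : ℕ) :
    seqPast x (k - i) = dropSeq i (seqPast x k) := by
  funext j; simp only [seqPast, dropSeq]; congr 1; push_cast; ring

/-- The event that the last `q` values of the Bernoulli shift `H` at time `m` are changed by the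
replacement of the term of index `0`. -/
def stateDiff {G : Type*} (H : (ℕ → G) → Fin 2) (q : ℕ) (m : ℤ) : Set (G × (ℤ → G)) :=
  {p | ∃ i : Fin q, H (seqPast p.2 (m - ((i : ℕ) : ℤ))) ≠
    H (seqPast (Function.update p.2 0 p.1) (m - ((i : ℕ) : ℤ)))}

/-- `stateDiff` in terms of the past at time `m`. -/
def pastStateDiff {G : Type*} (H : (ℕ → G) → Fin 2) (q : ℕ) (m : ℤ) : Set (G × (ℕ → G)) :=
  {y | ∃ i : Fin q, H (dropSeq i y.2) ≠ H (dropSeq i (pastUpdate m y))}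

theorem measurableSet_pastStateDiff {G : Type*} [MeasurableSpace G] {H : (ℕ → G) → Fin 2}
    (hH : Measurable H) (q : ℕ) (m : ℤ) : MeasurableSet (pastStateDiff H q m) := by
  have : pastStateDiff H q m =
      ⋃ i : Fin q, {y | H (dropSeq i y.2) = H (dropSeq i (pastUpdate m y))}ᶜ := by
    ext y; simp [pastStateDiff]
  rw [this]
  exact MeasurableSet.iUnion fun i => (measurableSet_eq_fun
    (hH.comp ((measurable_dropSeq _).comp measurable_snd))
    (hH.comp ((measurable_dropSeq _).comp (measurable_pastUpdate m)))).compl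

/-- Shows that the event is determined by the copy and the past at `m`, which is what makes the
conditional bound on resets applicable to it. -/
theorem mem_stateDiff_iff {G : Type*} {H : (ℕ → G) → Fin 2} {q : ℕ} {m : ℤ} {p : G × (ℤ → G)} :
    p ∈ stateDiff H q m ↔ (p.1, seqPast p.2 m) ∈ pastStateDiff H q m := by
  simp only [stateDiff, pastStateDiff, Set.mem_ofPred_eq, seqPast_sub, seqPast_update]

theorem measurableSet_stateDiff {G : Type*} [MeasurableSpace G] {H : (ℕ → G) → Fin 2}
    (hH : Measurable H) (q : ℕ) (m : ℤ) : MeasurableSet (stateDiff H q m) := by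
  have : stateDiff H q m = (fun p : G × (ℤ → G) => (p.1, seqPast p.2 m)) ⁻¹'
      pastStateDiff H q m := by
    ext p; exact mem_stateDiff_iff
  rw [this]
  exact (measurable_fst.prodMk ((measurable_seqPast m).comp measurable_snd))
    (measurableSet_pastStateDiff hH q m)

/-- The event that the recursion at time `u`, applied to the modified solution, returns different
values under the original and under the modified driving sequence. -/
def stepError {q : ℕ} (a : Fin q → ℝ) (b : Fin e → ℝ) (Z : (ℕ → ℝ × G₁) → Fin e → ℝ)
    (H : (ℕ → ℝ × G₁) → Fin 2) (u : ℤ) : Set ((ℝ × G₁) × (ℤ → ℝ × G₁)) :=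
  {p | ¬(0 < linearIndex a b
        (fun i : Fin q => H (seqPast (Function.update p.2 0 p.1) (u - 1 - ((i : ℕ) : ℤ))))
        (drivingSeq Z p.2 u) ↔
      0 < linearIndex a b
        (fun i : Fin q => H (seqPast (Function.update p.2 0 p.1) (u - 1 - ((i : ℕ) : ℤ))))
        (drivingSeq Z (Function.update p.2 0 p.1) u))}

/-- Deterministic core of the coupling. Without step errors in the block, the modified solution
obeys the original recursion there. Then agreement at `m` would persist to the end of the block, and
a reset at `m + K` would force agreement at the last `q` times. -/
theorem stateDiff_subset {q : ℕ} (hq : 1 ≤ q) {a : Fin q → ℝ} {b : Fin e → ℝ}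
    {Z : (ℕ → ℝ × G₁) → Fin e → ℝ} {H : (ℕ → ℝ × G₁) → Fin 2} {K : ℕ} {m : ℤ}
    {p : (ℝ × G₁) × (ℤ → ℝ × G₁)}
    (hY : ∀ t, SatisfiesAt (linearIndex a b) (drivingSeq Z p.2) (fun t => H (seqPast p.2 t)) t)
    (hY' : ∀ t, SatisfiesAt (linearIndex a b) (drivingSeq Z (Function.update p.2 0 p.1))
      (fun t => H (seqPast (Function.update p.2 0 p.1) t)) t)
    (herr : ∀ j < K + q, p ∉ stepError a b Z H (m + j + 1))
    (hp : p ∈ stateDiff H q (m + (K + q : ℕ))) :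
    p ∈ stateDiff H q m ∧ ¬IsReset (linearIndex a b) (drivingSeq Z p.2) (m + K) := by
  have hY'' : ∀ t, m < t → t ≤ m + (K + q : ℕ) →
      SatisfiesAt (linearIndex a b) (drivingSeq Z p.2)
        (fun t => H (seqPast (Function.update p.2 0 p.1) t)) t := by
    intro t h1 h2
    have h3 := herr (t - m - 1).toNat (by omega)
    rw [show m + ((t - m - 1).toNat : ℤ) + 1 = t by omega] at h3
    simp only [stepError, Set.mem_ofPred_eq, not_not] at h3
    have h4 := hY' t
    simp only [SatisfiesAt] at h4 ⊢
    rw [h4]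
    simp only [h3]
  obtain ⟨i, hi⟩ := hp
  have hi' := i.2
  refine ⟨?_, fun hR => hi ?_⟩
  · by_contra hm
    refine hi ?_
    refine eq_of_satisfiesAt (y := fun t => H (seqPast p.2 t)) (T := m + (K + q : ℕ)) (s := m)
      (fun t _ _ => hY t) hY'' (fun t h1 h2 => ?_) (by omega) (by omega)
    by_contra hne
    refine hm ⟨⟨(m - t).toNat, by omega⟩, ?_⟩
    simp only
    rw [show m - ((m - t).toNat : ℤ) = t by omega]
    exact hne
  · exact eq_of_isReset (y := fun t => H (seqPast p.2 t)) (T := m + (K + q : ℕ)) hR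
      (fun t _ _ => hY t) (fun t h1 h2 => hY'' t (by omega) h2) (by push_cast; omega) (by omega)

end Driving

/-! ### Probability estimates over one block. -/

section Estimates

variable {G₁ : Type*} [MeasurableSpace G₁] {ν : Measure (ℝ × G₁)} [IsProbabilityMeasure ν]
  {e q : ℕ} {a : Fin q → ℝ} {b : Fin e → ℝ} {Z : (ℕ → ℝ × G₁) → Fin e → ℝ}
  {H : (ℕ → ℝ × G₁) → Fin 2}

/-- Both indices in `stepError` carry the lags of the modified solution, so the two thresholds
differ only through `Z`. For `u ≠ 0` the shock at `u` is not replaced and is independent of these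
thresholds. -/
theorem measure_stepError_le {L : NNReal} (hL : LipschitzWith L (cdf (ν.map Prod.fst)))
    (hZ : Measurable Z) (hH : Measurable H) {u : ℤ} (hu : u ≠ 0) :
    (ν.prod (Measure.infinitePi fun _ : ℤ => ν)) (stepError a b Z H u) ≤
      ∫⁻ p, min 1 (ENNReal.ofReal (L * |b ⬝ᵥ (Z (seqPast p.2 (u - 1)) -
        Z (seqPast (Function.update p.2 0 p.1) (u - 1)))|))
        ∂(ν.prod (Measure.infinitePi fun _ : ℤ => ν)) := by
  have hb : Measurable fun z : Fin e → ℝ => b ⬝ᵥ z := by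
    simp only [dotProduct]; fun_prop
  have hc : Measurable fun y : (ℝ × G₁) × (ℕ → ℝ × G₁) =>
      lagSum a fun i : Fin q => H (dropSeq i (pastUpdate (u - 1) y)) :=
    (measurable_lagSum a).comp (measurable_pi_lambda _ fun i =>
      hH.comp ((measurable_dropSeq _).comp (measurable_pastUpdate _)))
  have h := prod_infinitePi_threshold_le hL u
    (A := fun y => lagSum a (fun i : Fin q => H (dropSeq i (pastUpdate (u - 1) y))) + b ⬝ᵥ Z y.2)
    (B := fun y => lagSum a (fun i : Fin q => H (dropSeq i (pastUpdate (u - 1) y))) +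
      b ⬝ᵥ Z (pastUpdate (u - 1) y))
    (hc.add (hb.comp (hZ.comp measurable_snd)))
    (hc.add (hb.comp (hZ.comp (measurable_pastUpdate _))))
  refine le_trans (le_of_eq ?_) (h.trans (le_of_eq ?_))
  · congr 1
    ext p
    simp only [stepError, Set.mem_ofPred_eq, linearIndex, drivingSeq, seqPast_sub, seqPast_update,
      Function.update_of_ne hu]
  · refine lintegral_congr fun p => ?_
    rw [add_sub_add_left_eq_sub, dotProduct_sub, seqPast_update]

/-- Conditionally on the past up to time `m`, a reset at time `m + K` has probability at least
`δ`, also when the past is enlarged by the independent copy. -/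
theorem measure_stateDiff_inter_isReset (hZ : Measurable Z) (hH : Measurable H) {δ : ℝ≥0∞} {K : ℕ}
    (hδ : ∀ A : Set (ℕ → ℝ × G₁), MeasurableSet A →
      δ * (Measure.infinitePi fun _ : ℤ => ν) {x | seqPast x (-(K : ℤ)) ∈ A} ≤
        (Measure.infinitePi fun _ : ℤ => ν)
          {x | seqPast x (-(K : ℤ)) ∈ A ∧ IsReset (linearIndex a b) (drivingSeq Z x) 0})
    (m : ℤ) :
    δ * (ν.prod (Measure.infinitePi fun _ : ℤ => ν)) (stateDiff H q m) ≤
      (ν.prod (Measure.infinitePi fun _ : ℤ => ν)) (stateDiff H q m ∩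
        {p | IsReset (linearIndex a b) (drivingSeq Z p.2) (m + K)}) := by
  set P := Measure.infinitePi fun _ : ℤ => ν
  have hRm : ∀ s, MeasurableSet {x : ℤ → ℝ × G₁ | IsReset (linearIndex a b) (drivingSeq Z x) s} :=
    fun s => measurable_drivingSeq hZ (measurableSet_isReset (measurable_linearIndex a b) s)
  have hDm := measurableSet_stateDiff hH q m
  have hRm' : MeasurableSet {p : (ℝ × G₁) × (ℤ → ℝ × G₁) |
      IsReset (linearIndex a b) (drivingSeq Z p.2) (m + K)} := measurable_snd (hRm _)
  rw [Measure.prod_apply hDm, Measure.prod_apply (hDm.inter hRm'),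
    ← lintegral_const_mul _ (measurable_measure_prodMk_left hDm)]
  refine lintegral_mono fun x' => ?_
  set A : Set (ℕ → ℝ × G₁) := Prod.mk x' ⁻¹' pastStateDiff H q m with hA
  have hAm : MeasurableSet A := measurable_prodMk_left (measurableSet_pastStateDiff hH q m)
  -- With the copy fixed, a shift by `m + K` brings the reset to time `0` and the past at `m` to the
  -- past at `-K`, where the hypothesis lives.
  have hshift := measurePreserving_shiftBy (measurePreserving_seqShift_infinitePi ν) (m + K)
  have e1 : Prod.mk x' ⁻¹' stateDiff H q m =
      shiftBy (m + K) ⁻¹' {x | seqPast x (-(K : ℤ)) ∈ A} := by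
    ext x
    simp only [Set.mem_preimage, mem_stateDiff_iff, Set.mem_ofPred_eq, hA, seqPast_shiftBy]
    rw [show -(K : ℤ) + (m + K) = m by ring]
  have e2 : Prod.mk x' ⁻¹' (stateDiff H q m ∩
        {p | IsReset (linearIndex a b) (drivingSeq Z p.2) (m + K)}) =
      shiftBy (m + K) ⁻¹'
        {x | seqPast x (-(K : ℤ)) ∈ A ∧ IsReset (linearIndex a b) (drivingSeq Z x) 0} := by
    ext x
    simp only [Set.mem_preimage, Set.mem_inter_iff, mem_stateDiff_iff, Set.mem_ofPred_eq, hA,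
      seqPast_shiftBy, drivingSeq_shiftBy, isReset_shiftBy]
    rw [show -(K : ℤ) + (m + K) = m by ring, zero_add]
  have hpm : MeasurableSet {x : ℤ → ℝ × G₁ | seqPast x (-(K : ℤ)) ∈ A} := measurable_seqPast _ hAm
  have hpm' : MeasurableSet {x : ℤ → ℝ × G₁ | seqPast x (-(K : ℤ)) ∈ A ∧
      IsReset (linearIndex a b) (drivingSeq Z x) 0} := hpm.inter (hRm 0)
  rw [e1, e2, hshift.measure_preimage hpm.nullMeasurableSet,
    hshift.measure_preimage hpm'.nullMeasurableSet]
  exact hδ A hAm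

/-- Contraction over a block of length `K + q` for the probability that two coupled solutions have
different states. -/
theorem measure_stateDiff_add_le (hq : 1 ≤ q) {L : NNReal}
    (hL : LipschitzWith L (cdf (ν.map Prod.fst))) (hZ : Measurable Z) (hH : Measurable H)
    {N : Seminorm ℝ (Fin e → ℝ)} {o : ℝ} {c : ℝ≥0∞}
    (hc : ∀ z, min 1 (ENNReal.ofReal (L * |b ⬝ᵥ z|)) ≤ c * ‖N z ^ o‖ₑ)
    {δ : ℝ≥0∞} {K : ℕ}
    (hδ : ∀ A : Set (ℕ → ℝ × G₁), MeasurableSet A →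
      δ * (Measure.infinitePi fun _ : ℤ => ν) {x | seqPast x (-(K : ℤ)) ∈ A} ≤
        (Measure.infinitePi fun _ : ℤ => ν)
          {x | seqPast x (-(K : ℤ)) ∈ A ∧ IsReset (linearIndex a b) (drivingSeq Z x) 0})
    (hsol : ∀ᵐ x ∂Measure.infinitePi fun _ : ℤ => ν, ∀ t,
      SatisfiesAt (linearIndex a b) (drivingSeq Z x) (fun t => H (seqPast x t)) t) (m : ℕ) :
    (ν.prod (Measure.infinitePi fun _ : ℤ => ν)) (stateDiff H q (m + (K + q) : ℕ)) ≤
      (1 - δ) * (ν.prod (Measure.infinitePi fun _ : ℤ => ν)) (stateDiff H q m) +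
      c * ∑ j ∈ Finset.range (K + q), ∫⁻ p, ‖N (Z (seqPast p.2 (m + j : ℕ)) -
        Z (seqPast (Function.update p.2 0 p.1) (m + j : ℕ))) ^ o‖ₑ
        ∂(ν.prod (Measure.infinitePi fun _ : ℤ => ν)) := by
  set P := Measure.infinitePi fun _ : ℤ => ν
  set Q := ν.prod P
  have hNm : Measurable fun z => ‖N z ^ o‖ₑ :=
    (N.continuous_of_pi.measurable.pow_const o).enorm
  have hRm : MeasurableSet {p : (ℝ × G₁) × (ℤ → ℝ × G₁) |
      IsReset (linearIndex a b) (drivingSeq Z p.2) ((m : ℤ) + K)} :=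
    measurable_snd (measurable_drivingSeq hZ
      (measurableSet_isReset (measurable_linearIndex a b) _))
  have hsolQ : ∀ᵐ p ∂Q, ∀ t,
      SatisfiesAt (linearIndex a b) (drivingSeq Z p.2) (fun t => H (seqPast p.2 t)) t :=
    Measure.quasiMeasurePreserving_snd.ae hsol
  -- The modified sequence has the law of the original one, so the almost sure recursion transfers
  -- to it.
  have hsolQ' : ∀ᵐ p ∂Q, ∀ t,
      SatisfiesAt (linearIndex a b) (drivingSeq Z (Function.update p.2 0 p.1))
        (fun t => H (seqPast (Function.update p.2 0 p.1) t)) t := by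
    have h := hsol
    rw [show P = Q.map fun p => Function.update p.2 0 p.1 from
      (map_update_prod_infinitePi ν).symm] at h
    exact ae_of_ae_map measurable_update_zero.aemeasurable h
  have hsub : (stateDiff H q (m + (K + q) : ℕ) : Set ((ℝ × G₁) × (ℤ → ℝ × G₁))) ≤ᵐ[Q]
      ((stateDiff H q m \ {p | IsReset (linearIndex a b) (drivingSeq Z p.2) ((m : ℤ) + K)}) ∪
        ⋃ j ∈ Finset.range (K + q), stepError a b Z H ((m : ℤ) + j + 1) : Set _) := by
    filter_upwards [hsolQ, hsolQ'] with p hp hp' hmem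
    by_cases herr : ∀ j < K + q, p ∉ stepError a b Z H ((m : ℤ) + j + 1)
    · left
      exact stateDiff_subset hq hp hp' herr hmem
    · right
      push Not at herr
      obtain ⟨j, hj, hj'⟩ := herr
      exact Set.mem_biUnion (Finset.mem_coe.2 (Finset.mem_range.2 hj)) hj'
  have hcontr : Q (stateDiff H q m \
      {p | IsReset (linearIndex a b) (drivingSeq Z p.2) ((m : ℤ) + K)}) ≤
      (1 - δ) * Q (stateDiff H q m) := by
    have h1 := measure_stateDiff_inter_isReset hZ hH hδ m
    have h2 := measure_inter_add_sdiff (μ := Q) (stateDiff H q m) hRm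
    rw [ENNReal.sub_mul fun _ _ => measure_ne_top _ _, one_mul]
    refine ENNReal.le_sub_of_add_le_left ?_ ?_
    · exact ne_top_of_le_ne_top (measure_ne_top _ _) h1
    · exact (add_le_add h1 le_rfl).trans h2.le
  calc Q (stateDiff H q (m + (K + q) : ℕ))
      ≤ _ := measure_mono_ae hsub
    _ ≤ _ := measure_union_le _ _
    _ ≤ (1 - δ) * Q (stateDiff H q m) +
        ∑ j ∈ Finset.range (K + q), Q (stepError a b Z H ((m : ℤ) + j + 1)) :=
      add_le_add hcontr (measure_biUnion_finset_le _ _)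
    _ ≤ _ := by
      rw [Finset.mul_sum]
      refine add_le_add le_rfl (Finset.sum_le_sum fun j _ => ?_)
      -- The times `m + j + 1` are positive, so the replaced term is never the current shock.
      refine (measure_stepError_le hL hZ hH (by omega)).trans ?_
      rw [add_sub_cancel_right, ← lintegral_const_mul]
      · push_cast
        exact lintegral_mono fun p => hc _
      · exact hNm.comp ((hZ.comp ((measurable_seqPast _).comp measurable_snd)).sub
          (hZ.comp ((measurable_seqPast _).comp measurable_update_zero)))

end Estimates

theorem measurable_binDist : Measurable fun y : Fin 2 × Fin 2 => binDist y.1 y.2 :=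
  Measurable.of_discrete

/-! ### Functional dependence coefficients on the canonical space. -/

section Coefficients

variable {Ω G E : Type*} [MeasurableSpace Ω] [MeasurableSpace G] {μ : Measure Ω}
  {ξ : ℤ → Ω → G} {ξ₀' : Ω → G} {ν : Measure G}

/-- The functional dependence coefficients only depend on the law of the driving sequence. -/
theorem fdTheta_one_eq_lintegral (hξ₀' : AEMeasurable ξ₀' μ) (hξ : ∀ t, Measurable (ξ t))
    {P : Measure (ℤ → G)} (hjoint : μ.map (fun ω => (ξ₀' ω, fun t => ξ t ω)) = ν.prod P)
    {d : E → E → ℝ} {H : (ℕ → G) → E}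
    (hd : Measurable fun y : (ℕ → G) × (ℕ → G) => d (H y.1) (H y.2)) (t : ℕ) :
    fdTheta μ ξ ξ₀' d H 1 t = ∫⁻ p, ‖d (H (seqPast p.2 t))
      (H (seqPast (Function.update p.2 0 p.1) t))‖ₑ ∂(ν.prod P) := by
  have hm : Measurable fun p : G × (ℤ → G) => ‖d (H (seqPast p.2 t))
      (H (seqPast (Function.update p.2 0 p.1) t))‖ₑ :=
    (hd.comp (((measurable_seqPast (t : ℤ)).comp measurable_snd).prodMk
      ((measurable_seqPast (t : ℤ)).comp measurable_update_zero))).enorm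
  rw [← hjoint, lintegral_map' hm.aemeasurable
    (hξ₀'.prodMk (measurable_pi_lambda _ hξ).aemeasurable), fdTheta,
    eLpNorm_one_eq_lintegral_enorm]
  refine lintegral_congr fun ω => ?_
  have : pastSeq (coupledSeq ξ ξ₀') t ω =
      seqPast (Function.update (fun t => ξ t ω) 0 (ξ₀' ω)) t := by
    funext j
    simp only [pastSeq, coupledSeq, seqPast, Function.update_apply]
    split_ifs <;> rfl
  rw [this]
  rfl

/-- The state of length `q ≥ 1` contains the current value, and `binDist` of two distinct values is
`1`. -/
theorem lintegral_binDist_le {q : ℕ} (hq : 1 ≤ q) {H : (ℕ → G) → Fin 2} (hH : Measurable H)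
    {Q : Measure (G × (ℤ → G))} (t : ℤ) :
    ∫⁻ p, ‖binDist (H (seqPast p.2 t)) (H (seqPast (Function.update p.2 0 p.1) t))‖ₑ ∂Q ≤
      Q (stateDiff H q t) := by
  rw [← lintegral_indicator_one (measurableSet_stateDiff hH q t)]
  refine lintegral_mono fun p => ?_
  by_cases h : H (seqPast p.2 t) = H (seqPast (Function.update p.2 0 p.1) t)
  · simp [h, binDist]
  · have hmem : p ∈ stateDiff H q t := ⟨⟨0, hq⟩, by simpa using h⟩
    rw [Set.indicator_of_mem hmem, Pi.one_apply]
    generalize H (seqPast p.2 t) = y at h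
    generalize H (seqPast (Function.update p.2 0 p.1) t) = y' at h
    fin_cases y <;> fin_cases y' <;> simp_all [binDist]

end Coefficients

/-- The tails of the functional dependence coefficients of a solution are bounded by those of the
covariate process. -/
theorem exists_fdTail_bound {Ω G₁ : Type*} [MeasurableSpace Ω] [MeasurableSpace G₁]
    {μ : Measure Ω} {ξ : ℤ → Ω → ℝ × G₁} {ξ₀' : Ω → ℝ × G₁} {ν : Measure (ℝ × G₁)}
    [IsProbabilityMeasure ν] (hξ₀' : AEMeasurable ξ₀' μ) (hξ : ∀ t, Measurable (ξ t))
    (hjoint : μ.map (fun ω => (ξ₀' ω, fun t => ξ t ω)) =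
      ν.prod (Measure.infinitePi fun _ : ℤ => ν))
    {q e : ℕ} (hq : 1 ≤ q) {a : Fin q → ℝ} {b : Fin e → ℝ} {Z : (ℕ → ℝ × G₁) → Fin e → ℝ}
    (hZ : Measurable Z) {L : NNReal} (hL : LipschitzWith L (cdf (ν.map Prod.fst)))
    {N : Seminorm ℝ (Fin e → ℝ)} (hN : ∀ z, N z = 0 → z = 0) {o : ℝ} (ho : 0 < o) (ho1 : o ≤ 1)
    {δ : ℝ} (hδ0 : 0 < δ) {K : ℕ}
    (hδ : ∀ A : Set (ℕ → ℝ × G₁), MeasurableSet A →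
      ENNReal.ofReal δ * (Measure.infinitePi fun _ : ℤ => ν) {x | seqPast x (-(K : ℤ)) ∈ A} ≤
        (Measure.infinitePi fun _ : ℤ => ν)
          {x | seqPast x (-(K : ℤ)) ∈ A ∧ IsReset (linearIndex a b) (drivingSeq Z x) 0}) :
    ∃ C ρ : ℝ, 0 < C ∧ 0 < ρ ∧ ρ < 1 ∧ ∀ H : (ℕ → ℝ × G₁) → Fin 2, Measurable H →
      (∀ᵐ x ∂Measure.infinitePi fun _ : ℤ => ν, ∀ t,
        SatisfiesAt (linearIndex a b) (drivingSeq Z x) (fun t => H (seqPast x t)) t) →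
      ∀ h : ℕ, 1 ≤ h → fdTail μ ξ ξ₀' binDist H 1 h ≤
        ENNReal.ofReal C * (ENNReal.ofReal ρ ^ h + ∑ i ∈ Finset.Icc 1 h, ENNReal.ofReal ρ ^ i *
          fdTail μ ξ ξ₀' (fun z z' => N (z - z') ^ o) Z 1 (h - i)) := by
  obtain ⟨c, hct, hc⟩ := N.exists_min_one_le hN b L L.2 ho ho1
  set P := Measure.infinitePi fun _ : ℤ => ν
  set Q := ν.prod P
  -- Lowering `δ` to at most `1 / 2` keeps `1 - δ'` positive, hence `ρ` as well. Below, `ρ` is the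
  -- root of order `B` of `1 - δ'`, so that one block contributes `ρ ^ B`.
  set δ' : ℝ := min δ (1 / 2) with hδ'
  have hδ'0 : 0 < δ' := lt_min hδ0 (by norm_num)
  have hδ'1 : δ' ≤ 1 / 2 := min_le_right _ _
  set B := K + q with hB
  have hB1 : 1 ≤ B := by omega
  set ρ : ℝ := (1 - δ') ^ ((B : ℝ)⁻¹) with hρ
  have hρ0 : 0 < ρ := Real.rpow_pos_of_pos (by linarith) _
  have hρ1 : ρ < 1 := Real.rpow_lt_one (by linarith) (by linarith) (by positivity)
  have hρB : ENNReal.ofReal ρ ^ B = 1 - ENNReal.ofReal δ' := by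
    rw [← ENNReal.ofReal_pow hρ0.le, hρ, Real.rpow_inv_natCast_pow (by linarith) (by omega),
      ENNReal.ofReal_sub _ hδ'0.le, ENNReal.ofReal_one]
  obtain ⟨C, hC0, hC⟩ := exists_tail_bound (R := ENNReal.ofReal ρ) hB1
    (ENNReal.ofReal_pos.2 hρ0).ne' (by rwa [ENNReal.ofReal_lt_one]) hct
  refine ⟨C, ρ, hC0, hρ0, hρ1, fun H hH hsol h hh => ?_⟩
  have hδ2 : ∀ A : Set (ℕ → ℝ × G₁), MeasurableSet A →
      ENNReal.ofReal δ' * P {x | seqPast x (-(K : ℤ)) ∈ A} ≤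
        P {x | seqPast x (-(K : ℤ)) ∈ A ∧ IsReset (linearIndex a b) (drivingSeq Z x) 0} :=
    fun A hA => (mul_le_mul_left (ENNReal.ofReal_le_ofReal (min_le_left _ _)) _).trans (hδ A hA)
  have hdN : Measurable fun y : (ℕ → ℝ × G₁) × (ℕ → ℝ × G₁) => N (Z y.1 - Z y.2) ^ o :=
    (N.continuous_of_pi.measurable.comp
      ((hZ.comp measurable_fst).sub (hZ.comp measurable_snd))).pow_const o
  have hdB : Measurable fun y : (ℕ → ℝ × G₁) × (ℕ → ℝ × G₁) => binDist (H y.1) (H y.2) :=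
    measurable_binDist.comp ((hH.comp measurable_fst).prodMk (hH.comp measurable_snd))
  -- The contraction holds for the probability that the whole state differs, not for the
  -- coefficients of the solution, which are only dominated by it.
  have key := hC (fun m => Q (stateDiff H q m))
    (fun t => fdTheta μ ξ ξ₀' (fun z z' => N (z - z') ^ o) Z 1 t) (fun m => prob_le_one)
    (fun m => by
      rw [hρB]
      simp only [fdTheta_one_eq_lintegral hξ₀' hξ hjoint
        (d := fun z z' => N (z - z') ^ o) hdN]
      exact measure_stateDiff_add_le hq hL hZ hH hc hδ2 hsol m) h hh
  refine le_trans (ENNReal.tsum_le_tsum fun k => ?_) key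
  rw [fdTheta_one_eq_lintegral hξ₀' hξ hjoint hdB]
  exact lintegral_binDist_le hq hH _

/-! ### From the conditional probability assumption to resets. -/

/-- A lower bound for the conditional probability of a union of two disjoint events. -/
theorem ofReal_mul_measure_le_of_condExp {Ω : Type*} {m m0 : MeasurableSpace Ω} {μ : Measure Ω}
    [IsProbabilityMeasure μ] (hm : m ≤ m0) {R₁ R₂ A : Set Ω} (hR₁ : MeasurableSet R₁)
    (hR₂ : MeasurableSet R₂) (hdisj : Disjoint R₁ R₂) (hA : MeasurableSet[m] A) {δ : ℝ}
    (h : ∀ᵐ ω ∂μ, δ ≤ (μ⟦R₁|m⟧) ω + (μ⟦R₂|m⟧) ω) :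
    ENNReal.ofReal δ * μ A ≤ μ (A ∩ (R₁ ∪ R₂)) := by
  have hA0 : MeasurableSet A := hm _ hA
  have hint : ∀ R : Set Ω, MeasurableSet R → Integrable (R.indicator fun _ => (1 : ℝ)) μ :=
    fun R hR => (integrable_const _).indicator hR
  have hset : ∀ R : Set Ω, MeasurableSet R → ∫ ω in A, (μ⟦R|m⟧) ω ∂μ = μ.real (A ∩ R) := by
    intro R hR
    rw [setIntegral_condExp hm (hint R hR) hA, setIntegral_indicator hR, setIntegral_const,
      smul_eq_mul, mul_one]
  have h1 : δ * μ.real A ≤ μ.real (A ∩ R₁) + μ.real (A ∩ R₂) := by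
    rw [← hset R₁ hR₁, ← hset R₂ hR₂,
      ← integral_add integrable_condExp.integrableOn integrable_condExp.integrableOn]
    calc δ * μ.real A = ∫ _ω in A, δ ∂μ := by rw [setIntegral_const, smul_eq_mul, mul_comm]
      _ ≤ _ := setIntegral_mono_ae (integrable_const _).integrableOn
        (integrable_condExp.add integrable_condExp).integrableOn h
  rw [← measureReal_union (hdisj.mono Set.inter_subset_right Set.inter_subset_right)
    (hA0.inter hR₂), ← Set.inter_union_distrib_left] at h1
  have h2 := ENNReal.ofReal_le_ofReal h1
  rwa [ENNReal.ofReal_mul' measureReal_nonneg, ofReal_measureReal, ofReal_measureReal] at h2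

section Linear

variable {Ω : Type*} {q e : ℕ} {a : Fin q → ℝ} {b : Fin e → ℝ} {Z : ℤ → Ω → Fin e → ℝ}
  {ε : ℤ → Ω → ℝ}

/-- `phiMinus` and `phiPlus` bound the lag contribution over all states, so either event fixes the
sign of the index at times `1, …, q` uniformly in the state. -/
theorem isReset_of_latentShock {ω : Ω}
    (h : 0 < phiMinus a + ⨅ t : Fin q, latentShock b Z ε ((t : ℤ) + 1) ω ∨
      phiPlus a + (⨆ t : Fin q, latentShock b Z ε ((t : ℤ) + 1) ω) ≤ 0) :
    IsReset (linearIndex a b) (fun t => (Z (t - 1) ω, ε t ω)) 0 := by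
  have hlin : ∀ (r : Fin q) (y : Fin q → Fin 2),
      linearIndex a b y (Z (0 + ((r : ℤ) + 1) - 1) ω, ε (0 + ((r : ℤ) + 1)) ω) =
        lagSum a y + latentShock b Z ε ((r : ℤ) + 1) ω := by
    intro r y
    simp only [linearIndex, latentShock, zero_add, add_assoc]
  refine h.imp (fun h r y => ?_) fun h r y => ?_
  · have h1 : phiMinus a ≤ lagSum a y := ciInf_le (Set.finite_range _).bddBelow y
    have h2 := ciInf_le (Set.finite_range
      fun t : Fin q => latentShock b Z ε ((t : ℤ) + 1) ω).bddBelow r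
    rw [hlin]; linarith
  · have h1 : lagSum a y ≤ phiPlus a := le_ciSup (Set.finite_range _).bddAbove y
    have h2 := le_ciSup (Set.finite_range
      fun t : Fin q => latentShock b Z ε ((t : ℤ) + 1) ω).bddAbove r
    rw [hlin]; linarith

/-- At a single state and a single time the two events impose opposite signs on the same index.
Disjointness turns the sum of their conditional probabilities into that of one union. -/
theorem disjoint_latentShock (hq : 1 ≤ q) :
    Disjoint {ω | 0 < phiMinus a + ⨅ t : Fin q, latentShock b Z ε ((t : ℤ) + 1) ω}
      {ω | phiPlus a + (⨆ t : Fin q, latentShock b Z ε ((t : ℤ) + 1) ω) ≤ 0} := by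
  rw [Set.disjoint_left]
  intro ω h1 h2
  simp only [Set.mem_ofPred_eq] at h1 h2
  have e1 : phiMinus a ≤ lagSum a 0 := ciInf_le (Set.finite_range _).bddBelow 0
  have e2 : lagSum a 0 ≤ phiPlus a := le_ciSup (Set.finite_range _).bddAbove 0
  have e3 := ciInf_le (Set.finite_range
    fun t : Fin q => latentShock b Z ε ((t : ℤ) + 1) ω).bddBelow ⟨0, hq⟩
  have e4 := le_ciSup (Set.finite_range
    fun t : Fin q => latentShock b Z ε ((t : ℤ) + 1) ω).bddAbove ⟨0, hq⟩
  linarith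

theorem measurable_latentShock [MeasurableSpace Ω] (hZ : ∀ t, Measurable (Z t))
    (hε : ∀ t, Measurable (ε t)) (t : ℤ) : Measurable (latentShock b Z ε t) := by
  have hb : Measurable fun z : Fin e → ℝ => b ⬝ᵥ z := by
    simp only [dotProduct]; fun_prop
  exact (hb.comp (hZ _)).add (hε t)

end Linear

/-! ### The solution as a Bernoulli shift, and assembly of the theorem. -/

theorem measurableSet_satisfiesAt {G₁ : Type*} [MeasurableSpace G₁] {q e : ℕ} {a : Fin q → ℝ}
    {b : Fin e → ℝ} {Z : (ℕ → ℝ × G₁) → Fin e → ℝ} (hZ : Measurable Z)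
    {H : (ℕ → ℝ × G₁) → Fin 2} (hH : Measurable H) :
    MeasurableSet {x : ℤ → ℝ × G₁ | ∀ t,
      SatisfiesAt (linearIndex a b) (drivingSeq Z x) (fun t => H (seqPast x t)) t} := by
  have hm : ∀ t : ℤ, MeasurableSet {x : ℤ → ℝ × G₁ |
      SatisfiesAt (linearIndex a b) (drivingSeq Z x) (fun t => H (seqPast x t)) t} := by
    intro t
    have hy : Measurable fun (x : ℤ → ℝ × G₁) (i : Fin q) =>
        H (seqPast x (t - 1 - ((i : ℕ) : ℤ))) :=
      measurable_pi_lambda _ fun i => hH.comp (measurable_seqPast _)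
    have hx : Measurable fun x : ℤ → ℝ × G₁ => drivingSeq Z x t :=
      (measurable_pi_apply t).comp (measurable_drivingSeq hZ)
    have hg : Measurable fun x : ℤ → ℝ × G₁ => linearIndex a b
        (fun i : Fin q => H (seqPast x (t - 1 - ((i : ℕ) : ℤ)))) (drivingSeq Z x t) := by
      have h := (measurable_linearIndex a b).comp (hy.prodMk hx)
      simpa only [Function.comp_def, Function.uncurry_apply_pair] using h
    have hpos : MeasurableSet {x : ℤ → ℝ × G₁ | 0 < linearIndex a b
        (fun i : Fin q => H (seqPast x (t - 1 - ((i : ℕ) : ℤ)))) (drivingSeq Z x t)} :=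
      hg measurableSet_Ioi
    have hite : Measurable fun x : ℤ → ℝ × G₁ => if 0 < linearIndex a b
        (fun i : Fin q => H (seqPast x (t - 1 - ((i : ℕ) : ℤ)))) (drivingSeq Z x t)
        then (1 : Fin 2) else 0 := Measurable.ite hpos measurable_const measurable_const
    simp only [SatisfiesAt]
    exact measurableSet_eq_fun (hH.comp (measurable_seqPast t)) hite
  rw [Set.ofPred_forall]
  exact MeasurableSet.iInter hm

/-- The stationary solution as a function of the past of the sequence `ξ`. -/
noncomputable def shiftRepresentation {G₁ : Type*} {q e : ℕ} (a : Fin q → ℝ) (b : Fin e → ℝ)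
    (Z : (ℕ → ℝ × G₁) → Fin e → ℝ) (p : ℕ → ℝ × G₁) : Fin 2 :=
  limitValue (linearIndex a b) fun j => (Z (dropSeq (j + 1) p), (p j).1)

theorem measurable_shiftRepresentation {G₁ : Type*} [MeasurableSpace G₁] {q e : ℕ}
    (a : Fin q → ℝ) (b : Fin e → ℝ) {Z : (ℕ → ℝ × G₁) → Fin e → ℝ} (hZ : Measurable Z) :
    Measurable (shiftRepresentation a b Z) :=
  (measurable_limitValue (measurable_linearIndex a b)).comp
    (measurable_pi_lambda _ fun j => (hZ.comp (measurable_dropSeq _)).prodMk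
      (measurable_fst.comp (measurable_pi_apply j)))

theorem limitValue_seqPast_drivingSeq {G₁ : Type*} {q e : ℕ} (a : Fin q → ℝ) (b : Fin e → ℝ)
    (Z : (ℕ → ℝ × G₁) → Fin e → ℝ) (x : ℤ → ℝ × G₁) (t : ℤ) :
    limitValue (linearIndex a b) (seqPast (drivingSeq Z x) t) =
      shiftRepresentation a b Z (seqPast x t) := by
  rw [shiftRepresentation]
  congr 1
  funext j
  rw [← seqPast_sub]
  simp only [seqPast, drivingSeq]
  congr 2
  funext i
  congr 1
  push_cast
  ring

theorem mainTheorem10 {Ω : Type*} [MeasurableSpace Ω] (μ : Measure Ω) [IsProbabilityMeasure μ]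
    (q : ℕ) (hq : 1 ≤ q) :
    -- Part 1: existence and uniqueness of a stationary and ergodic solution.
    (∀ (E' : Type*) [MeasurableSpace E'] (g : (Fin q → Fin 2) → E' → ℝ) (ζ : ℤ → Ω → E'),
      Measurable (Function.uncurry g) →
      (∀ t, Measurable (ζ t)) →
      IsStationaryErgodicProcess μ ζ →
      0 < μ {ω | 0 < ⨅ r : (Fin q → Fin 2) × Fin q, g r.1 (ζ ((r.2 : ℤ) + 1) ω)} +
          μ {ω | (⨆ r : (Fin q → Fin 2) × Fin q, g r.1 (ζ ((r.2 : ℤ) + 1) ω)) ≤ 0} →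
      ∃ Y : ℤ → Ω → Fin 2, IsUniqueStationaryErgodicSolution μ g ζ Y) ∧
    -- Part 2: functional dependence of the solution in the linear case.
    (∀ (G₁ : Type*) [MeasurableSpace G₁] (e : ℕ) (a : Fin q → ℝ) (b : Fin e → ℝ)
      (ε : ℤ → Ω → ℝ) (η : ℤ → Ω → G₁) (Z : ℤ → Ω → (Fin e → ℝ))
      (H' : (ℕ → G₁) → (Fin e → ℝ)) (ξ : ℤ → Ω → ℝ × G₁) (ξ₀' : Ω → ℝ × G₁)
      (N : Seminorm ℝ (Fin e → ℝ)) (o : ℝ),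
      -- `N` is an arbitrary norm on `ℝ^e`, and the distance on `ℝ^e` is `N (z - z') ^ o`
      (∀ z, N z = 0 → z = 0) → 0 < o → o ≤ 1 →
      -- the variables `ξ t = (ε t, η t)` are i.i.d., and `Z t = H' (η t, η (t-1), …)`
      (∀ t ω, ξ t ω = (ε t ω, η t ω)) →
      (∀ t, Measurable (ξ t)) → iIndepFun ξ μ → (∀ t, IdentDistrib (ξ t) (ξ 0) μ μ) →
      (∀ t, Measurable (Z t)) → Measurable H' → (∀ t, Z t =ᵐ[μ] fun ω => H' (pastSeq η t ω)) →
      -- `ξ₀'` is a copy of `ξ 0` which is independent of the whole sequence `ξ`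
      IdentDistrib ξ₀' (ξ 0) μ μ → IndepFun ξ₀' (fun ω t => ξ t ω) μ →
      -- the c.d.f. of `ε t` is Lipschitz and takes values in `(0, 1)`
      (∃ L, LipschitzWith L (cdf (μ.map (ε 0)))) →
      (∀ x, cdf (μ.map (ε 0)) x ∈ Set.Ioo (0 : ℝ) 1) →
      -- the lower bound for the conditional probabilities
      (∃ δ : ℝ, 0 < δ ∧ ∃ K : ℕ, 0 < K ∧ ∀ᵐ ω ∂μ,
        δ ≤ (μ⟦{ω | 0 < phiMinus a + ⨅ t : Fin q, latentShock b Z ε ((t : ℤ) + 1) ω} |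
                pastSigma ξ (-(K : ℤ))⟧) ω +
            (μ⟦{ω | phiPlus a + (⨆ t : Fin q, latentShock b Z ε ((t : ℤ) + 1) ω) ≤ 0} |
                pastSigma ξ (-(K : ℤ))⟧) ω) →
      ∃ Y : ℤ → Ω → Fin 2,
        IsUniqueStationaryErgodicSolution μ (linearIndex a b)
          (fun t ω => (Z (t - 1) ω, ε t ω)) Y ∧
        -- `Y` is a Bernoulli shift
        (∃ H : (ℕ → ℝ × G₁) → Fin 2, Measurable H ∧
          ∀ t, Y t =ᵐ[μ] fun ω => H (pastSeq ξ t ω)) ∧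
        -- the bound, for whatever representation of `Y` as a Bernoulli shift
        ∃ C ρ : ℝ, 0 < C ∧ 0 < ρ ∧ ρ < 1 ∧
          ∀ H : (ℕ → ℝ × G₁) → Fin 2, Measurable H →
            (∀ t, Y t =ᵐ[μ] fun ω => H (pastSeq ξ t ω)) →
            ∀ h : ℕ, 1 ≤ h →
              fdTail μ ξ ξ₀' binDist H 1 h ≤
                ENNReal.ofReal C * (ENNReal.ofReal ρ ^ h +
                  ∑ i ∈ Finset.Icc 1 h, ENNReal.ofReal ρ ^ i *
                    fdTail μ ξ ξ₀' (fun z z' => N (z - z') ^ o)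
                      (fun x => H' (fun j => (x j).2)) 1 (h - i))) := by
  have : Nonempty (Fin q) := ⟨⟨0, hq⟩⟩
  constructor
  · intro E' _ g ζ hg hζ herg hpos
    refine ⟨_, isUniqueStationaryErgodicSolution_limitValue hg hζ herg ?_⟩
    -- One of the two events has positive probability, and each of them is contained in a reset at
    -- time `0`.
    rcases add_pos_iff.1 hpos with h | h
    · refine h.trans_le (measure_mono fun ω hω => Or.inl fun r y => ?_)
      rw [zero_add]
      exact lt_of_lt_of_le hω (ciInf_le (Set.finite_range
        fun r : (Fin q → Fin 2) × Fin q => g r.1 (ζ ((r.2 : ℤ) + 1) ω)).bddBelow (y, r))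
    · refine h.trans_le (measure_mono fun ω hω => Or.inr fun r y => ?_)
      rw [zero_add]
      exact le_trans (le_ciSup (Set.finite_range
        fun r : (Fin q → Fin 2) × Fin q => g r.1 (ζ ((r.2 : ℤ) + 1) ω)).bddAbove (y, r)) hω
  · intro G₁ _ e a b ε η Z H' ξ ξ₀' N o hN ho ho1 hξeq hξ hindep hident hZ hH' hZH' hcopy hcopyind
      ⟨L, hL⟩ _ ⟨δ, hδ0, K, _, hδ⟩
    set X : Ω → ℤ → ℝ × G₁ := fun ω t => ξ t ω with hX
    have hXm : Measurable X := measurable_pi_lambda _ hξ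
    set ν := μ.map (ξ 0) with hν
    have : IsProbabilityMeasure ν := Measure.isProbabilityMeasure_map (hξ 0).aemeasurable
    set P := Measure.infinitePi fun _ : ℤ => ν with hP
    have hlaw : μ.map X = P := by
      rw [hX, hindep.map_fun_eq_infinitePi_map hξ]
      simp only [fun t => (hident t).map_eq, hP, hν]
    have hξ₀' : AEMeasurable ξ₀' μ := hcopy.aemeasurable_fst
    have hjoint : μ.map (fun ω => (ξ₀' ω, fun t => ξ t ω)) = ν.prod P := by
      rw [hcopyind.map_prod_eq_prod_map_map hξ₀' hXm.aemeasurable, hcopy.map_eq]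
      exact congrArg _ hlaw
    have hε : ∀ t, ε t = fun ω => (ξ t ω).1 := fun t => by funext ω; rw [hξeq]
    have hεm : ∀ t, Measurable (ε t) := fun t => by
      rw [hε]; exact measurable_fst.comp (hξ t)
    have hLν : LipschitzWith L (cdf (ν.map Prod.fst)) := by
      rw [hν, Measure.map_map measurable_fst (hξ 0)]
      rw [hε 0] at hL
      exact hL
    set Z₀ : (ℕ → ℝ × G₁) → Fin e → ℝ := fun x => H' fun j => (x j).2 with hZ₀
    have hZ₀m : Measurable Z₀ := hH'.comp
      (measurable_pi_lambda _ fun j => measurable_snd.comp (measurable_pi_apply j))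
    set ζ : ℤ → Ω → (Fin e → ℝ) × ℝ := fun t ω => (Z (t - 1) ω, ε t ω) with hζ
    have hζm : ∀ t, Measurable (ζ t) := fun t => (hZ _).prodMk (hεm t)
    -- `Z t` is a function of the past of `η` only almost surely for each `t`; as times are
    -- countable, one null set suffices for the whole path.
    have hdrive : ∀ᵐ ω ∂μ, ∀ t, ζ t ω = drivingSeq Z₀ (X ω) t := by
      filter_upwards [ae_all_iff.2 hZH'] with ω hω t
      simp only [hζ, drivingSeq, hω, hε]
      congr 2
      funext j
      simp only [pastSeq, seqPast, hX, hξeq]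
    have hergξ : IsStationaryErgodicProcess μ ξ := by
      rw [IsStationaryErgodicProcess, processLaw, show μ.map (fun ω t => ξ t ω) = P from hlaw]
      exact ergodic_seqShift_infinitePi ν
    have hergζ : IsStationaryErgodicProcess μ ζ := by
      refine hergξ.of_past hξ (F := fun p => (Z₀ (dropSeq 1 p), (p 0).1))
        ((hZ₀m.comp (measurable_dropSeq 1)).prodMk (measurable_fst.comp (measurable_pi_apply 0)))
        fun t => ?_
      filter_upwards [hdrive] with ω hω
      rw [hω t, drivingSeq]
      have h1 := seqPast_sub (X ω) t 1
      rw [Nat.cast_one] at h1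
      rw [h1]
      change (Z₀ (dropSeq 1 (pastSeq ξ t ω)), _) = _
      simp [pastSeq, hX]
    have hcond : ∀ A : Set (ℕ → ℝ × G₁), MeasurableSet A →
        ENNReal.ofReal δ * μ {ω | seqPast (X ω) (-(K : ℤ)) ∈ A} ≤
          μ {ω | seqPast (X ω) (-(K : ℤ)) ∈ A ∧ IsReset (linearIndex a b) (fun t => ζ t ω) 0} := by
      intro A hA
      have hle : pastSigma ξ (-(K : ℤ)) ≤ ‹MeasurableSpace Ω› := iSup_le fun j => (hξ _).comap_le
      have hAm : MeasurableSet[pastSigma ξ (-(K : ℤ))] {ω | seqPast (X ω) (-(K : ℤ)) ∈ A} := by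
        have hmeas : Measurable[pastSigma ξ (-(K : ℤ))] fun ω => seqPast (X ω) (-(K : ℤ)) := by
          refine @measurable_pi_lambda _ _ _ (pastSigma ξ (-(K : ℤ))) _ _ fun j => ?_
          exact (comap_measurable (ξ (-(K : ℤ) - (j : ℤ)))).mono
            (le_iSup (fun j : ℕ => MeasurableSpace.comap (ξ (-(K : ℤ) - (j : ℤ))) inferInstance) j)
            le_rfl
        exact hmeas hA
      have hsh := fun t => measurable_latentShock (b := b) hZ hεm t
      refine (ofReal_mul_measure_le_of_condExp hle ?_ ?_ (disjoint_latentShock hq) hAm hδ).trans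
        (measure_mono fun ω hω => ⟨hω.1, isReset_of_latentShock hω.2⟩)
      · exact measurableSet_lt measurable_const
          (measurable_const.add (Measurable.iInf fun t : Fin q => hsh _))
      · exact measurableSet_le
          (measurable_const.add (Measurable.iSup fun t : Fin q => hsh _)) measurable_const
    -- The bound is moved to the law `P` of the sequence, the space on which the block estimates are
    -- stated.
    have hcondP : ∀ A : Set (ℕ → ℝ × G₁), MeasurableSet A →
        ENNReal.ofReal δ * P {x | seqPast x (-(K : ℤ)) ∈ A} ≤
          P {x | seqPast x (-(K : ℤ)) ∈ A ∧
            IsReset (linearIndex a b) (drivingSeq Z₀ x) 0} := by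
      intro A hA
      have hpm : MeasurableSet {x : ℤ → ℝ × G₁ | seqPast x (-(K : ℤ)) ∈ A} :=
        measurable_seqPast _ hA
      have hpm' : MeasurableSet {x : ℤ → ℝ × G₁ | seqPast x (-(K : ℤ)) ∈ A ∧
          IsReset (linearIndex a b) (drivingSeq Z₀ x) 0} :=
        hpm.inter (measurable_drivingSeq hZ₀m
          (measurableSet_isReset (measurable_linearIndex a b) _))
      rw [← hlaw, Measure.map_apply hXm hpm, Measure.map_apply hXm hpm']
      refine (hcond A hA).trans (measure_mono_ae ?_)
      filter_upwards [hdrive] with ω hω hmem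
      refine ⟨hmem.1, ?_⟩
      have h2 := hmem.2
      simp only [hω] at h2
      exact h2
    have hpos : 0 < μ {ω | IsReset (linearIndex a b) (fun t => ζ t ω) 0} := by
      -- With a trivial conditioning event the assumption says that a reset has probability at least
      -- `δ`.
      have h := hcond Set.univ MeasurableSet.univ
      simp only [Set.mem_univ, Set.ofPred_true, measure_univ, mul_one, true_and] at h
      exact (ENNReal.ofReal_pos.2 hδ0).trans_le h
    have hY := isUniqueStationaryErgodicSolution_limitValue (measurable_linearIndex a b) hζm
      hergζ hpos
    refine ⟨_, hY, ⟨shiftRepresentation a b Z₀, measurable_shiftRepresentation a b hZ₀m,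
      fun t => ?_⟩, ?_⟩
    · filter_upwards [hdrive] with ω hω
      have h1 : pastSeq ζ t ω = seqPast (drivingSeq Z₀ (X ω)) t := by
        funext j; exact hω _
      rw [h1, limitValue_seqPast_drivingSeq]
      rfl
    · obtain ⟨C, ρ, hC, hρ0, hρ1, hbound⟩ := exists_fdTail_bound hξ₀' hξ hjoint hq hZ₀m hLν hN ho
        ho1 hδ0 hcondP
      refine ⟨C, ρ, hC, hρ0, hρ1, fun H hH hHY h hh => hbound H hH ?_ h hh⟩
      -- Any function `H` representing `Y` inherits the recursion along almost every i.i.d. path.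
      -- This is all the bound asks of `H`, so `C` and `ρ` do not depend on it.
      rw [← hP, ← hlaw, ae_map_iff hXm.aemeasurable (measurableSet_satisfiesAt hZ₀m hH)]
      filter_upwards [hdrive, hY.2.1, ae_all_iff.2 hHY] with ω hω hsol hrep t
      have h1 := hsol t
      simp only [hrep, hω] at h1
      exact h1
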